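/- Let $V$ be a finite-dimensional right vector space over the quaternions $\mathbf{H}$, with its usual topology, and let $\mathcal{A}$ be a finite set of linear hyperplanes (subspaces of $\mathbf{H}$-codimension one) in $V$. Write $\mathcal{M}_{\mathcal{A}} = V \setminus \bigcup_{H\in\mathcal{A}} H$ and let $H^d(\mathcal{M}_{\mathcal{A}})$ be its cohomology with integer coefficients. Let $L(\mathcal{A})$ be the set of all intersections of elements of $\mathcal{A}$ (including the empty intersection $V$), ordered by reverse inclusion, with $\mathrm{rk}(X)=\mathrm{codim}_V(X)$ and $\mu(X)=\mu(V,X)$, where $\mu$ is the Möbius function of the poset $L(\mathcal{A})$. Put $$p_{\mathcal{A}}(t)=\sum_{d\ge 0} \mathrm{rk}\, H^{3d}(\mathcal{M}_{\mathcal{A}})\, t^d, \qquad \pi_{\mathcal{A}}(t)=\sum_{X\in L(\mathcal{A})} (-1)^{\mathrm{rk}(X)}\mu(X)\, t^{\mathrm{rk}(X)}.$$ For $H_0\in\mathcal{A}$ let $\mathcal{A}^0=\mathcal{A}\setminus\{H_0\}$, an arrangement in $V$, and let $\mathcal{A}_0=\{H_0\cap H : H\in\mathcal{A},\ H_0\not\subseteq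 H\}$, an arrangement in $H_0$, whose complement is taken in $H_0$. Then: 1. For every $d\ge 0$, $H^d(\mathcal{M}_{\mathcal{A}})$ is a free $\mathbf{Z}$-module of finite rank, and it is zero unless $3$ divides $d$. 2. For every $H_0\in\mathcal{A}$ and every $d \ge 0$ there is an isomorphism of abelian groups $H^d(\mathcal{M}_{\mathcal{A}})\cong H^d(\mathcal{M}_{\mathcal{A}^0})\oplus H^{d-3}(\mathcal{M}_{\mathcal{A}_0})$ (where the last summand is $0$ for $d<3$), and $$p_{\mathcal{A}}(t)=p_{\mathcal{A}^0}(t)+t\,p_{\mathcal{A}_0}(t).$$ 3. For every $d\ge 0$, $$\mathrm{rk}\, H^{3d}(\mathcal{M}_{\mathcal{A}})=\sum_{X\in L(\mathcal{A}),\ \mathrm{rk}(X)=d}(-1)^{\mathrm{rk}(X)}\mu(X),$$ that is, $p_{\mathcal{A}}(t)=\pi_{\mathcal{A}}(t)$. -/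

import Mathlib

open CategoryTheory Quaternion

noncomputable section

universe u

/-- The singular cochain complex `Hom(C_•(X), ℤ)` of a topological space `X`, where `C_•(X)` is
the singular chain complex of `X` with integer coefficients. -/
def singularCochainComplex (X : Type u) [TopologicalSpace X] :
    HomologicalComplex (ModuleCat.{u} ℤ) (ComplexShape.down ℕ).symm :=
  (((linearYoneda ℤ (ModuleCat.{u} ℤ)).obj (ModuleCat.of ℤ (ULift.{u} ℤ))).mapHomologicalComplex
      (ComplexShape.down ℕ).symm).obj
    (((AlgebraicTopology.singularChainComplexFunctor (ModuleCat.{u} ℤ)).obj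
      (ModuleCat.of ℤ (ULift.{u} ℤ))).obj (TopCat.of X)).op

/-- The singular cohomology group `H^d(X; ℤ)`. -/
def singularCohomology (X : Type u) [TopologicalSpace X] (d : ℕ) : ModuleCat.{u} ℤ :=
  (singularCochainComplex X).homology d

/-- A central hyperplane arrangement in a right quaternionic vector space `V` (a module over the
opposite ring of `ℍ`): a finite set of linear subspaces of codimension one. -/
structure CentralArrangement (V : Type u) [AddCommGroup V] [Module ℍ[ℝ]ᵐᵒᵖ V] where
  hyperplanes : Set (Submodule ℍ[ℝ]ᵐᵒᵖ V)
  finite_hyperplanes : hyperplanes.Finite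
  codim_eq_one : ∀ H ∈ hyperplanes, Module.finrank ℍ[ℝ]ᵐᵒᵖ (V ⧸ H) = 1

namespace CentralArrangement

section

variable {V : Type u} [AddCommGroup V] [Module ℍ[ℝ]ᵐᵒᵖ V]

/-- The complement `M_A` of the union of the hyperplanes. -/
def complement (A : CentralArrangement V) : Set V :=
  (⋃ H ∈ A.hyperplanes, (H : Set V))ᶜ

/-- The arrangement obtained by omitting `H₀`. -/
def deletion (A : CentralArrangement V) (H₀ : Submodule ℍ[ℝ]ᵐᵒᵖ V) : CentralArrangement V where
  hyperplanes := A.hyperplanes \ {H₀}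
  finite_hyperplanes := A.finite_hyperplanes.sdiff
  codim_eq_one H hH := A.codim_eq_one H hH.1

theorem finrank_quotient_comap_subtype (H₀ H : Submodule ℍ[ℝ]ᵐᵒᵖ V)
    (h : Module.finrank ℍ[ℝ]ᵐᵒᵖ (V ⧸ H) = 1) (hle : ¬ H₀ ≤ H) :
    Module.finrank ℍ[ℝ]ᵐᵒᵖ (H₀ ⧸ H.comap H₀.subtype) = 1 := by
  have hs : IsSimpleModule ℍ[ℝ]ᵐᵒᵖ (V ⧸ H) := isSimpleModule_iff_finrank_eq_one.2 h
  have hco : IsCoatom H := isSimpleModule_iff_isCoatom.1 hs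
  have hsup : H₀ ⊔ H = ⊤ := hco.2 _ (right_lt_sup.2 hle)
  have hr : LinearMap.range (H.mkQ ∘ₗ H₀.subtype) = ⊤ := by
    rw [LinearMap.range_comp, Submodule.range_subtype, Submodule.map_mkQ_eq_top, sup_comm, hsup]
  have hk : LinearMap.ker (H.mkQ ∘ₗ H₀.subtype) = H.comap H₀.subtype := by
    rw [LinearMap.ker_comp, Submodule.ker_mkQ]
  rw [← hk, (LinearMap.quotKerEquivRange _).finrank_eq, hr, finrank_top, h]

/-- The arrangement in `H₀` consisting of the intersections `H₀ ∩ H`, for the hyperplanes `H`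
that do not contain `H₀`. -/
def restriction (A : CentralArrangement V) (H₀ : Submodule ℍ[ℝ]ᵐᵒᵖ V) :
    CentralArrangement H₀ where
  hyperplanes := (fun H => H.comap H₀.subtype) '' {H ∈ A.hyperplanes | ¬ H₀ ≤ H}
  finite_hyperplanes := (A.finite_hyperplanes.sep _).image _
  codim_eq_one := by
    rintro _ ⟨H, ⟨hH, hle⟩, rfl⟩
    exact finrank_quotient_comap_subtype H₀ H (A.codim_eq_one H hH) hle

/-- The intersection lattice `L(A)`: all intersections of hyperplanes of `A` (including the empty
intersection `V`), ordered by reverse inclusion. -/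
def IntersectionLattice (A : CentralArrangement V) : Type u :=
  {X : (Submodule ℍ[ℝ]ᵐᵒᵖ V)ᵒᵈ // ∃ S ⊆ A.hyperplanes, OrderDual.ofDual X = sInf S}

namespace IntersectionLattice

variable {A : CentralArrangement V}

instance : PartialOrder A.IntersectionLattice :=
  inferInstanceAs (PartialOrder {X : (Submodule ℍ[ℝ]ᵐᵒᵖ V)ᵒᵈ //
    ∃ S ⊆ A.hyperplanes, OrderDual.ofDual X = sInf S})

instance : Finite A.IntersectionLattice :=
  Set.Finite.to_subtype ((A.finite_hyperplanes.finite_subsets.image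
    (fun S => OrderDual.toDual (sInf S))).subset (by
      rintro X ⟨S, hS, h⟩
      exact ⟨S, hS, h.symm⟩))

instance : Fintype A.IntersectionLattice := Fintype.ofFinite _

instance : DecidableEq A.IntersectionLattice := Classical.decEq _

open Classical in
instance : LocallyFiniteOrder A.IntersectionLattice := Fintype.toLocallyFiniteOrder

/-- The element of `L(A)` as a subspace of `V`. -/
def toSubmodule (X : A.IntersectionLattice) : Submodule ℍ[ℝ]ᵐᵒᵖ V := OrderDual.ofDual X.1

/-- The minimal element of `L(A)` is the whole space `V`. -/
instance : OrderBot A.IntersectionLattice where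
  bot := ⟨OrderDual.toDual ⊤, ∅, Set.empty_subset _, sInf_empty.symm⟩
  bot_le X := show X.toSubmodule ≤ ⊤ from le_top

/-- The rank of an element of `L(A)` is its codimension in `V`. -/
def rk (X : A.IntersectionLattice) : ℕ := Module.finrank ℍ[ℝ]ᵐᵒᵖ (V ⧸ X.toSubmodule)

/-- `μ(X) = μ(V, X)`, where `μ` is the Möbius function of `L(A)`. -/
def moebius (X : A.IntersectionLattice) : ℤ := IncidenceAlgebra.mu ℤ ⊥ X

end IntersectionLattice

/-- The polynomial `π_A(t) = ∑ (-1)^{rk X} μ(X) t^{rk X}`, summed over `X ∈ L(A)`. -/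
def latticePolynomial (A : CentralArrangement V) : Polynomial ℤ :=
  ∑ X : A.IntersectionLattice, Polynomial.monomial X.rk ((-1) ^ X.rk * X.moebius)

/-- The series `p_A(t) = ∑_d rk H^{3d}(M_A; ℤ) t^d`. -/
def poincareSeries [TopologicalSpace V] (A : CentralArrangement V) : PowerSeries ℤ :=
  PowerSeries.mk fun d => (Module.finrank ℤ (singularCohomology A.complement (3 * d)) : ℤ)

end

end CentralArrangement

end

/-! The proof is by deletion and restriction. Fix a hyperplane H₀ and write A⁰ and A₀ for the
deletion and the restriction. The complement of A⁰ is the disjoint union of the open set M_A and the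
relatively closed set M_{A₀}, and M_{A₀} has a trivial tubular neighbourhood M_{A₀} × ℍ there
(`exists_tube`). Excision and the Thom isomorphism, obtained as four suspensions, give Hⁿ(M_{A⁰},
M_A) ≅ Hⁿ⁻⁴(M_{A₀}). The exact sequence of the pair becomes Hⁿ⁻⁴(M_{A₀}) → Hⁿ(M_{A⁰}) → Hⁿ(M_A) →
Hⁿ⁻³(M_{A₀}) → Hⁿ⁺¹(M_{A⁰}). Suppose the groups of A⁰ and A₀ are free and live in degrees divisible
by three. If 3 divides n, the two outer terms vanish and the remaining short exact sequence splits;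
otherwise both neighbours of Hⁿ(M_A) vanish (`isThreeConcentrated_of_gysin`). Induction on the
number of hyperplanes, starting from the contractible space V, gives freeness, concentration and the
recursion for p_A.

On the combinatorial side, μ(X) is the sum of (-1)^|T| over the subfamilies T with intersection X
(`moebius_eq_sum`). Sorting subfamilies by whether they contain H₀ shows that π_A obeys the same
recursion (`latticePolynomial_deletion_restriction`).

The cohomology theory is built from singular simplices. Relative cochains are attached to a pair of
families of simplices closed under faces, so that "small" simplices are treated on the same footing
as the simplices of a subset. Subdivision and prism operators are first constructed by iterated
cones on formal tuples of points and then realized as singular chains; naturality under affine maps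
makes them compatible with faces. Excision follows because cochains that vanish on small simplices
form an acyclic complex (`isZero_homology_of_union`). -/

noncomputable section

/-! ### Cones and chain homotopies on tuples of points -/

/-- Formal integral combinations of `k`-tuples of points. -/
abbrev TupleChain (E : Type*) (k : ℕ) : Type _ := (Fin k → E) →₀ ℤ

namespace TupleChain

variable {E F E' F' : Type*}

/-- The alternating sum of the faces of a tuple. -/
def bdry (E : Type*) (k : ℕ) : TupleChain E (k + 1) →ₗ[ℤ] TupleChain E k :=
  Finsupp.linearCombination ℤ fun w =>
    ∑ i : Fin (k + 1), ((-1 : ℤ) ^ (i : ℕ)) • Finsupp.single (w ∘ i.succAbove) 1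

/-- The cone over a chain with a given apex. -/
def cone (b : E) (k : ℕ) : TupleChain E k →ₗ[ℤ] TupleChain E (k + 1) :=
  Finsupp.lmapDomain ℤ ℤ fun w => (Fin.cons b w : Fin (k + 1) → E)

/-- The image of a chain under a map of points. -/
def push (g : E → F) (k : ℕ) : TupleChain E k →ₗ[ℤ] TupleChain F k :=
  Finsupp.lmapDomain ℤ ℤ fun w => g ∘ w

theorem bdry_single (k : ℕ) (w : Fin (k + 1) → E) :
    bdry E k (Finsupp.single w 1) =
      ∑ i : Fin (k + 1), ((-1 : ℤ) ^ (i : ℕ)) • Finsupp.single (w ∘ i.succAbove) 1 := by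
  simp [bdry]

@[simp]
theorem cone_single (b : E) (k : ℕ) (w : Fin k → E) (a : ℤ) :
    cone b k (Finsupp.single w a) = Finsupp.single (Fin.cons b w : Fin (k + 1) → E) a := by
  simp [cone]

@[simp]
theorem push_single (g : E → F) (k : ℕ) (w : Fin k → E) (a : ℤ) :
    push g k (Finsupp.single w a) = Finsupp.single (g ∘ w) a := by
  simp [push]

theorem hom_ext {M : Type*} [AddCommGroup M] {k : ℕ} {f g : TupleChain E k →ₗ[ℤ] M}
    (h : ∀ w, f (Finsupp.single w 1) = g (Finsupp.single w 1)) : f = g :=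
  Finsupp.lhom_ext' fun w => LinearMap.ext_ring (h w)

/-- The index `k` counts vertices, so degree zero is spanned by the empty tuple and plays the role
of the augmentation. There the cone formula has no correction term. -/
theorem bdry_cone_zero (b : E) (c : TupleChain E 0) : bdry E 0 (cone b 0 c) = c := by
  have : bdry E 0 ∘ₗ cone b 0 = LinearMap.id := by
    refine hom_ext fun w => ?_
    simp only [LinearMap.comp_apply, cone_single, bdry_single]
    rw [Fin.sum_univ_one, Fin.val_zero, pow_zero, one_smul, LinearMap.id_apply]
    congr 1
  exact LinearMap.congr_fun this c

/-- Omitting the apex returns `c`; every other face is a cone over a face of `c` whose index has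
moved by one, whence the minus sign. -/
theorem bdry_cone_succ (b : E) (k : ℕ) (c : TupleChain E (k + 1)) :
    bdry E (k + 1) (cone b (k + 1) c) = c - cone b k (bdry E k c) := by
  have : bdry E (k + 1) ∘ₗ cone b (k + 1) = LinearMap.id - cone b k ∘ₗ bdry E k := by
    refine hom_ext fun w => ?_
    simp only [LinearMap.comp_apply, cone_single, bdry_single, LinearMap.sub_apply,
      LinearMap.id_apply, map_sum, map_smul]
    rw [Fin.sum_univ_succ, sub_eq_add_neg, ← Finset.sum_neg_distrib]
    congr 1
    · simp only [Fin.val_zero, pow_zero, one_smul]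
      congr 1
    · refine Finset.sum_congr rfl fun i _ => ?_
      rw [Fin.val_succ, pow_succ, mul_neg_one, neg_smul]
      congr 3
      funext j
      refine Fin.cases ?_ (fun j => ?_) j
      · simp
      · simp
  exact LinearMap.congr_fun this c

/-- This form lets `∂∂ = 0` be deduced from the cone formula alone. -/
theorem single_eq_cone (k : ℕ) (w : Fin (k + 1) → E) (a : ℤ) :
    Finsupp.single w a = cone (w 0) k (Finsupp.single (Fin.tail w) a) := by
  rw [cone_single, Fin.cons_self_tail]

theorem bdry_bdry (k : ℕ) (c : TupleChain E (k + 2)) : bdry E k (bdry E (k + 1) c) = 0 := by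
  have : bdry E k ∘ₗ bdry E (k + 1) = 0 := by
    clear c
    induction k with
    | zero =>
      refine hom_ext fun w => ?_
      rw [LinearMap.comp_apply, single_eq_cone, bdry_cone_succ, map_sub, bdry_cone_zero, sub_self,
        LinearMap.zero_apply]
    | succ k ih =>
      refine hom_ext fun w => ?_
      have := LinearMap.congr_fun ih (Finsupp.single (Fin.tail w) 1)
      rw [LinearMap.comp_apply, LinearMap.zero_apply] at this
      rw [LinearMap.comp_apply, single_eq_cone, bdry_cone_succ, map_sub, bdry_cone_succ, this,
        map_zero, sub_zero, sub_self, LinearMap.zero_apply]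
  exact LinearMap.congr_fun this c

theorem push_bdry (g : E → F) (k : ℕ) (c : TupleChain E (k + 1)) :
    push g k (bdry E k c) = bdry F k (push g (k + 1) c) := by
  have : push g k ∘ₗ bdry E k = bdry F k ∘ₗ push g (k + 1) := by
    refine hom_ext fun w => ?_
    simp [bdry_single, Function.comp_assoc]
  exact LinearMap.congr_fun this c

theorem push_cone (g : E → F) (b : E) (k : ℕ) (c : TupleChain E k) :
    push g (k + 1) (cone b k c) = cone (g b) k (push g k c) := by
  have : push g (k + 1) ∘ₗ cone b k = cone (g b) k ∘ₗ push g k := by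
    refine hom_ext fun w => ?_
    simp only [LinearMap.comp_apply, cone_single, push_single]
    congr 1
    funext j
    refine Fin.cases ?_ (fun j => ?_) j <;> simp
  exact LinearMap.congr_fun this c

/-- The subdivision operator with apices `b`. -/
def subdiv (b : ∀ k, (Fin (k + 1) → E) → E) : ∀ k, TupleChain E k →ₗ[ℤ] TupleChain E k
  | 0 => LinearMap.id
  | k + 1 => Finsupp.linearCombination ℤ fun w =>
      cone (b k w) k (subdiv b k (bdry E k (Finsupp.single w 1)))

/-- The chain homotopy between two operators obtained by repeatedly taking cones with
apices `b`. -/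
def coneHomotopy (α β : ∀ k, TupleChain E k →ₗ[ℤ] TupleChain F k)
    (b : ∀ k, (Fin (k + 1) → E) → F) : ∀ k, TupleChain E k →ₗ[ℤ] TupleChain F (k + 1)
  | 0 => 0
  | k + 1 => Finsupp.linearCombination ℤ fun w =>
      cone (b k w) (k + 1) (α (k + 1) (Finsupp.single w 1) - β (k + 1) (Finsupp.single w 1) -
        coneHomotopy α β b k (bdry E k (Finsupp.single w 1)))

theorem subdiv_single (b : ∀ k, (Fin (k + 1) → E) → E) (k : ℕ) (w : Fin (k + 1) → E) :
    subdiv b (k + 1) (Finsupp.single w 1) =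
      cone (b k w) k (subdiv b k (bdry E k (Finsupp.single w 1))) := by
  simp [subdiv]

theorem coneHomotopy_single (α β : ∀ k, TupleChain E k →ₗ[ℤ] TupleChain F k)
    (b : ∀ k, (Fin (k + 1) → E) → F) (k : ℕ) (w : Fin (k + 1) → E) :
    coneHomotopy α β b (k + 1) (Finsupp.single w 1) =
      cone (b k w) (k + 1) (α (k + 1) (Finsupp.single w 1) - β (k + 1) (Finsupp.single w 1) -
        coneHomotopy α β b k (bdry E k (Finsupp.single w 1))) := by
  simp [coneHomotopy]

/-- The cone is taken over the subdivided boundary, which is a cycle by induction, so the correction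
term of the cone formula drops out. -/
theorem bdry_subdiv (b : ∀ k, (Fin (k + 1) → E) → E) (k : ℕ) (c : TupleChain E (k + 1)) :
    bdry E k (subdiv b (k + 1) c) = subdiv b k (bdry E k c) := by
  have : bdry E k ∘ₗ subdiv b (k + 1) = subdiv b k ∘ₗ bdry E k := by
    clear c
    induction k with
    | zero =>
      refine hom_ext fun w => ?_
      rw [LinearMap.comp_apply, subdiv_single, bdry_cone_zero, LinearMap.comp_apply]
    | succ k ih =>
      refine hom_ext fun w => ?_
      have := LinearMap.congr_fun ih (bdry E (k + 1) (Finsupp.single w 1))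
      rw [LinearMap.comp_apply, LinearMap.comp_apply, bdry_bdry, map_zero] at this
      rw [LinearMap.comp_apply, subdiv_single, bdry_cone_succ, this, map_zero, sub_zero,
        LinearMap.comp_apply]
  exact LinearMap.congr_fun this c

/-- An acyclic carrier argument: the chain `α w - β w - h ∂w` is a cycle by induction on `k`, hence
is the boundary of its own cone. Agreement on the empty tuple starts the induction. -/
theorem bdry_coneHomotopy {α β : ∀ k, TupleChain E k →ₗ[ℤ] TupleChain F k}
    {b : ∀ k, (Fin (k + 1) → E) → F}
    (hα : ∀ k c, bdry F k (α (k + 1) c) = α k (bdry E k c))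
    (hβ : ∀ k c, bdry F k (β (k + 1) c) = β k (bdry E k c)) (h0 : α 0 = β 0)
    (k : ℕ) (c : TupleChain E (k + 1)) :
    bdry F (k + 1) (coneHomotopy α β b (k + 1) c) =
      α (k + 1) c - β (k + 1) c - coneHomotopy α β b k (bdry E k c) := by
  have : bdry F (k + 1) ∘ₗ coneHomotopy α β b (k + 1) =
      α (k + 1) - β (k + 1) - coneHomotopy α β b k ∘ₗ bdry E k := by
    clear c
    induction k with
    | zero =>
      refine hom_ext fun w => ?_
      rw [LinearMap.comp_apply, coneHomotopy_single, bdry_cone_succ]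
      simp [coneHomotopy, hα, hβ, h0]
    | succ k ih =>
      refine hom_ext fun w => ?_
      have := LinearMap.congr_fun ih (bdry E (k + 1) (Finsupp.single w 1))
      simp only [LinearMap.comp_apply, LinearMap.sub_apply, bdry_bdry, map_zero, sub_zero] at this
      rw [LinearMap.comp_apply, coneHomotopy_single, bdry_cone_succ, map_sub (bdry F (k + 1)),
        map_sub (bdry F (k + 1)), this, hα, hβ, sub_self, map_zero, sub_zero]
      rfl
  exact LinearMap.congr_fun this c

/-- Naturality in the points. Applied to the affine inclusion of a face, it identifies an operator
on the face with the restriction of the operator on the whole simplex. -/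
theorem push_subdiv {b : ∀ k, (Fin (k + 1) → E) → E} {b' : ∀ k, (Fin (k + 1) → E') → E'}
    {g : E → E'} (hb : ∀ k w, g (b k w) = b' k (g ∘ w)) (k : ℕ) (c : TupleChain E k) :
    push g k (subdiv b k c) = subdiv b' k (push g k c) := by
  have : push g k ∘ₗ subdiv b k = subdiv b' k ∘ₗ push g k := by
    clear c
    induction k with
    | zero => rfl
    | succ k ih =>
      refine hom_ext fun w => ?_
      have := LinearMap.congr_fun ih (bdry E k (Finsupp.single w 1))
      rw [LinearMap.comp_apply, LinearMap.comp_apply] at this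
      rw [LinearMap.comp_apply, LinearMap.comp_apply, subdiv_single, push_cone, this, push_bdry,
        push_single, subdiv_single, hb]
  exact LinearMap.congr_fun this c

theorem push_coneHomotopy {α β : ∀ k, TupleChain E k →ₗ[ℤ] TupleChain F k}
    {b : ∀ k, (Fin (k + 1) → E) → F} {α' β' : ∀ k, TupleChain E' k →ₗ[ℤ] TupleChain F' k}
    {b' : ∀ k, (Fin (k + 1) → E') → F'} {g : E → E'} {h : F → F'}
    (hα : ∀ k c, push h k (α k c) = α' k (push g k c))
    (hβ : ∀ k c, push h k (β k c) = β' k (push g k c))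
    (hb : ∀ k w, h (b k w) = b' k (g ∘ w)) (k : ℕ) (c : TupleChain E k) :
    push h (k + 1) (coneHomotopy α β b k c) = coneHomotopy α' β' b' k (push g k c) := by
  have : push h (k + 1) ∘ₗ coneHomotopy α β b k = coneHomotopy α' β' b' k ∘ₗ push g k := by
    clear c
    induction k with
    | zero => simp [coneHomotopy]
    | succ k ih =>
      refine hom_ext fun w => ?_
      have := LinearMap.congr_fun ih (bdry E k (Finsupp.single w 1))
      rw [LinearMap.comp_apply, LinearMap.comp_apply] at this
      rw [LinearMap.comp_apply, LinearMap.comp_apply, coneHomotopy_single, push_cone,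
        map_sub (push h (k + 1)), map_sub (push h (k + 1)), this, push_bdry, hα, hβ, push_single, coneHomotopy_single, hb]
  exact LinearMap.congr_fun this c

end TupleChain

/-! ### Affine maps of standard simplices -/

namespace stdSimplex

/-- The affine map between standard simplices with prescribed values on the vertices. -/
def affMap {ι κ : Type*} [Fintype ι] [Fintype κ] (w : ι → stdSimplex ℝ κ) :
    C(stdSimplex ℝ ι, stdSimplex ℝ κ) where
  toFun t := ⟨fun j => ∑ i, t i * w i j, fun j => Finset.sum_nonneg fun i _ =>
      mul_nonneg (zero_le t i) (zero_le (w i) j), by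
    rw [Finset.sum_comm]
    simp only [← Finset.mul_sum, sum_eq_one, mul_one]⟩
  continuous_toFun := by
    refine Continuous.subtype_mk (continuous_pi fun j => continuous_finsetSum _ fun i _ => ?_) _
    exact ((continuous_apply i).comp continuous_subtype_val).mul continuous_const

variable {ι κ l : Type*} [Fintype ι] [Fintype κ] [Fintype l]

theorem affMap_apply (w : ι → stdSimplex ℝ κ) (t : stdSimplex ℝ ι) (j : κ) :
    affMap w t j = ∑ i, t i * w i j := rfl

@[simp]
theorem affMap_vertex [DecidableEq ι] (w : ι → stdSimplex ℝ κ) (i : ι) :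
    affMap w (vertex i) = w i := by
  ext j
  simp [affMap_apply, Pi.single_apply]

@[simp]
theorem affMap_comp_vertex [DecidableEq ι] (w : ι → stdSimplex ℝ κ) :
    affMap w ∘ vertex = w :=
  funext fun i => affMap_vertex w i

@[simp]
theorem affMap_vertex_eq_id [DecidableEq ι] :
    affMap (vertex : ι → stdSimplex ℝ ι) = ContinuousMap.id _ := by
  ext t j
  simp [affMap_apply, Pi.single_apply]

theorem affMap_comp (w : κ → stdSimplex ℝ l) (u : ι → stdSimplex ℝ κ) :
    (affMap w).comp (affMap u) = affMap (affMap w ∘ u) := by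
  ext t j
  simp only [ContinuousMap.comp_apply, affMap_apply, Function.comp_apply, Finset.sum_mul,
    Finset.mul_sum]
  rw [Finset.sum_comm]
  simp only [mul_assoc]

theorem affMap_affMap (w : κ → stdSimplex ℝ l) (u : ι → stdSimplex ℝ κ) (t : stdSimplex ℝ ι) :
    affMap w (affMap u t) = affMap (affMap w ∘ u) t := by
  rw [← affMap_comp, ContinuousMap.comp_apply]

theorem affMap_const (v : stdSimplex ℝ κ) :
    affMap (fun _ : ι => v) = ContinuousMap.const _ v := by
  ext t j
  simp [affMap_apply, ← Finset.sum_mul]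

theorem affMap_vertex_comp [DecidableEq κ] (f : ι → κ) (t : stdSimplex ℝ ι) :
    affMap (fun i => vertex (f i)) t = map f t := by
  ext j
  rw [affMap_apply, map_coe, FunOnFinite.linearMap_apply_apply, Finset.sum_filter]
  refine Finset.sum_congr rfl fun i _ => ?_
  simp only [vertex_coe, Pi.single_apply, mul_ite, mul_one, mul_zero, eq_comm]

/-- The point of the standard simplex with equal coordinates. -/
def uniform (k : ℕ) : stdSimplex ℝ (Fin (k + 1)) :=
  ⟨fun _ => ((k : ℝ) + 1)⁻¹, fun _ => by positivity, by
    simp only [Finset.sum_const, Finset.card_univ, Fintype.card_fin, nsmul_eq_mul]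
    push_cast
    field_simp⟩

/-- The barycenter of a tuple of points in a standard simplex. -/
def tupleBarycenter (k : ℕ) (w : Fin (k + 1) → stdSimplex ℝ κ) : stdSimplex ℝ κ :=
  affMap w (uniform k)

theorem affMap_tupleBarycenter (u : κ → stdSimplex ℝ l) (k : ℕ) (w : Fin (k + 1) → stdSimplex ℝ κ) :
    affMap u (tupleBarycenter k w) = tupleBarycenter k (affMap u ∘ w) :=
  affMap_affMap _ _ _

end stdSimplex

open stdSimplex

/-! ### Singular chains, subdivision and prisms -/

/-- Singular simplices with `k` vertices. -/
abbrev SingSimplex (X : Type*) [TopologicalSpace X] (k : ℕ) : Type _ :=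
  C(stdSimplex ℝ (Fin k), X)

/-- Integral singular chains on simplices with `k` vertices. -/
abbrev SingChain (X : Type*) [TopologicalSpace X] (k : ℕ) : Type _ :=
  SingSimplex X k →₀ ℤ

namespace SingSimplex

variable {X Y E : Type*} [TopologicalSpace X] [TopologicalSpace Y]

/-- A face of a singular simplex. -/
def face {k : ℕ} (i : Fin (k + 1)) (σ : SingSimplex X (k + 1)) : SingSimplex X k :=
  σ.comp (affMap (vertex ∘ i.succAbove))

theorem comp_face (φ : C(X, Y)) {k : ℕ} (i : Fin (k + 1)) (σ : SingSimplex X (k + 1)) :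
    face i (φ.comp σ) = φ.comp (face i σ) := rfl

/-- The singular simplex obtained by precomposing with an affine simplex. -/
def affComp {m : ℕ} (σ : SingSimplex X m) (k : ℕ) (w : Fin k → stdSimplex ℝ (Fin m)) :
    SingSimplex X k :=
  σ.comp (affMap w)

theorem face_affComp {m : ℕ} (σ : SingSimplex X m) (k : ℕ) (w : Fin (k + 1) → stdSimplex ℝ (Fin m))
    (i : Fin (k + 1)) : face i (σ.affComp (k + 1) w) = σ.affComp k (w ∘ i.succAbove) := by
  rw [face, affComp, ContinuousMap.comp_assoc, affMap_comp, ← Function.comp_assoc,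
    affMap_comp_vertex, affComp]

theorem face_eq_affComp {k : ℕ} (i : Fin (k + 1)) (σ : SingSimplex X (k + 1)) :
    face i σ = σ.affComp k (vertex ∘ i.succAbove) := rfl

theorem affComp_affComp {m n : ℕ} (σ : SingSimplex X m) (u : Fin n → stdSimplex ℝ (Fin m)) (k : ℕ)
    (w : Fin k → stdSimplex ℝ (Fin n)) :
    (σ.affComp n u).affComp k w = σ.affComp k (affMap u ∘ w) := by
  rw [affComp, affComp, affComp, ContinuousMap.comp_assoc, affMap_comp]

@[simp]
theorem affComp_vertex {m : ℕ} (σ : SingSimplex X m) : σ.affComp m vertex = σ := by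
  rw [affComp, affMap_vertex_eq_id, ContinuousMap.comp_id]

/-- The singular simplex in `Y` obtained from a homotopy, a singular simplex, and an affine
simplex in the prism. -/
def prismComp (h : C(X × stdSimplex ℝ (Fin 2), Y)) {m : ℕ} (σ : SingSimplex X m) (k : ℕ)
    (w : Fin k → stdSimplex ℝ (Fin m) × stdSimplex ℝ (Fin 2)) : SingSimplex Y k :=
  h.comp ((σ.affComp k (Prod.fst ∘ w)).prodMk (affMap (Prod.snd ∘ w)))

theorem face_prismComp (h : C(X × stdSimplex ℝ (Fin 2), Y)) {m : ℕ} (σ : SingSimplex X m) (k : ℕ)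
    (w : Fin (k + 1) → stdSimplex ℝ (Fin m) × stdSimplex ℝ (Fin 2)) (i : Fin (k + 1)) :
    face i (prismComp h σ (k + 1) w) = prismComp h σ k (w ∘ i.succAbove) := by
  have h1 := face_affComp σ k (Prod.fst ∘ w) i
  have h2 := face_affComp (ContinuousMap.id _) k (Prod.snd ∘ w) i
  simp only [affComp, ContinuousMap.id_comp] at h2
  rw [prismComp, prismComp, comp_face, ← Function.comp_assoc, ← Function.comp_assoc, ← h1, ← h2]
  rfl

theorem prismComp_affComp (h : C(X × stdSimplex ℝ (Fin 2), Y)) {m n : ℕ} (σ : SingSimplex X m)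
    (u : Fin n → stdSimplex ℝ (Fin m)) (k : ℕ)
    (w : Fin k → stdSimplex ℝ (Fin n) × stdSimplex ℝ (Fin 2)) :
    prismComp h (σ.affComp n u) k w = prismComp h σ k (Prod.map (affMap u) id ∘ w) := by
  rw [prismComp, affComp_affComp]
  rfl

end SingSimplex

namespace SingChain

open SingSimplex TupleChain

variable {X Y E : Type*} [TopologicalSpace X] [TopologicalSpace Y]

/-- The boundary of singular chains. -/
def boundary (X : Type*) [TopologicalSpace X] (k : ℕ) : SingChain X (k + 1) →ₗ[ℤ] SingChain X k :=
  Finsupp.linearCombination ℤ fun σ =>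
    ∑ i : Fin (k + 1), ((-1 : ℤ) ^ (i : ℕ)) • Finsupp.single (face i σ) 1

theorem boundary_single (k : ℕ) (σ : SingSimplex X (k + 1)) :
    boundary X k (Finsupp.single σ 1) =
      ∑ i : Fin (k + 1), ((-1 : ℤ) ^ (i : ℕ)) • Finsupp.single (face i σ) 1 := by
  simp [boundary]

theorem hom_ext {M : Type*} [AddCommGroup M] {k : ℕ} {f g : SingChain X k →ₗ[ℤ] M}
    (h : ∀ σ, f (Finsupp.single σ 1) = g (Finsupp.single σ 1)) : f = g :=
  Finsupp.lhom_ext' fun σ => LinearMap.ext_ring (h σ)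

/-- The singular chain obtained by realizing tuples as singular simplices. -/
def realize (F : ∀ k, (Fin k → E) → SingSimplex X k) (k : ℕ) : TupleChain E k →ₗ[ℤ] SingChain X k :=
  Finsupp.lmapDomain ℤ ℤ (F k)

@[simp]
theorem realize_single (F : ∀ k, (Fin k → E) → SingSimplex X k) (k : ℕ) (w : Fin k → E) (a : ℤ) :
    realize F k (Finsupp.single w a) = Finsupp.single (F k w) a := by
  simp [realize]

/-- Through this lemma every boundary identity proved for tuples passes to singular chains. -/
theorem boundary_realize {F : ∀ k, (Fin k → E) → SingSimplex X k}
    (hF : ∀ k w i, face i (F (k + 1) w) = F k (w ∘ i.succAbove)) (k : ℕ)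
    (c : TupleChain E (k + 1)) :
    boundary X k (realize F (k + 1) c) = realize F k (bdry E k c) := by
  have : boundary X k ∘ₗ realize F (k + 1) = realize F k ∘ₗ bdry E k := by
    refine TupleChain.hom_ext fun w => ?_
    simp [boundary_single, bdry_single, hF]
  exact LinearMap.congr_fun this c

theorem realize_push {E' : Type*} {F : ∀ k, (Fin k → E) → SingSimplex X k}
    {F' : ∀ k, (Fin k → E') → SingSimplex X k} (g : E' → E)
    (hF : ∀ k w, F' k w = F k (g ∘ w)) (k : ℕ) (c : TupleChain E' k) :
    realize F' k c = realize F k (push g k c) := by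
  have : realize F' k = realize F k ∘ₗ push g k := by
    refine TupleChain.hom_ext fun w => ?_
    simp [hF]
  exact LinearMap.congr_fun this c

theorem realize_mem_supported {F : ∀ k, (Fin k → E) → SingSimplex X k} {k : ℕ}
    {s : Set (SingSimplex X k)} {t : Set (Fin k → E)} (h : ∀ w ∈ t, F k w ∈ s) {c : TupleChain E k}
    (hc : c ∈ Finsupp.supported ℤ ℤ t) : realize F k c ∈ Finsupp.supported ℤ ℤ s := by
  classical
  rw [Finsupp.mem_supported] at hc ⊢
  intro σ hσ
  obtain ⟨w, hw, rfl⟩ := Finset.mem_image.1 (Finsupp.mapDomain_support hσ)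
  exact h w (hc hw)

theorem boundary_boundary (k : ℕ) (c : SingChain X (k + 2)) :
    boundary X k (boundary X (k + 1) c) = 0 := by
  have : boundary X k ∘ₗ boundary X (k + 1) = 0 := by
    refine hom_ext fun σ => ?_
    -- A singular simplex is the realization of the tuple of its vertices, so the identity is
    -- inherited from tuples.
    have h := realize_single (affComp σ) (k + 2) vertex 1
    rw [affComp_vertex] at h
    rw [LinearMap.comp_apply, ← h, boundary_realize (face_affComp σ),
      boundary_realize (face_affComp σ), bdry_bdry, map_zero, LinearMap.zero_apply]
  exact LinearMap.congr_fun this c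

/-- The barycentric subdivision of singular chains. -/
def sd (X : Type*) [TopologicalSpace X] (k : ℕ) : SingChain X k →ₗ[ℤ] SingChain X k :=
  Finsupp.linearCombination ℤ fun σ =>
    realize (affComp σ) k (subdiv tupleBarycenter k (Finsupp.single vertex 1))

/-- The chain homotopy between the identity and the barycentric subdivision. -/
def sdHomotopy (X : Type*) [TopologicalSpace X] (k : ℕ) : SingChain X k →ₗ[ℤ] SingChain X (k + 1) :=
  Finsupp.linearCombination ℤ fun σ => realize (affComp σ) (k + 1)
    (coneHomotopy (fun _ => LinearMap.id) (subdiv tupleBarycenter) tupleBarycenter k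
      (Finsupp.single vertex 1))

/-- The prism operator of a homotopy. -/
def prism (h : C(X × stdSimplex ℝ (Fin 2), Y)) (k : ℕ) : SingChain X k →ₗ[ℤ] SingChain Y (k + 1) :=
  Finsupp.linearCombination ℤ fun σ => realize (prismComp h σ) (k + 1)
    (coneHomotopy (push fun p => (p, vertex 1)) (push fun p => (p, vertex 0))
      (fun _ w => (w 0, vertex 0)) k (Finsupp.single vertex 1))

theorem sd_single (k : ℕ) (σ : SingSimplex X k) : sd X k (Finsupp.single σ 1) =
    realize (affComp σ) k (subdiv tupleBarycenter k (Finsupp.single vertex 1)) := by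
  simp [sd]

theorem sdHomotopy_single (k : ℕ) (σ : SingSimplex X k) : sdHomotopy X k (Finsupp.single σ 1) =
    realize (affComp σ) (k + 1) (coneHomotopy (fun _ => LinearMap.id) (subdiv tupleBarycenter) tupleBarycenter
      k (Finsupp.single vertex 1)) := by
  simp [sdHomotopy]

theorem prism_single (h : C(X × stdSimplex ℝ (Fin 2), Y)) (k : ℕ) (σ : SingSimplex X k) :
    prism h k (Finsupp.single σ 1) = realize (prismComp h σ) (k + 1)
      (coneHomotopy (push fun p => (p, vertex 1)) (push fun p => (p, vertex 0))
        (fun _ w => (w 0, vertex 0)) k (Finsupp.single vertex 1)) := by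
  simp [prism]

theorem push_affMap_subdiv {m n : ℕ} (u : Fin m → stdSimplex ℝ (Fin n)) (k : ℕ)
    (c : TupleChain (stdSimplex ℝ (Fin m)) k) :
    push (affMap u) k (subdiv tupleBarycenter k c) = subdiv tupleBarycenter k (push (affMap u) k c) :=
  push_subdiv (affMap_tupleBarycenter u) k c

theorem realize_affComp_face_subdiv {k : ℕ} (σ : SingSimplex X (k + 1)) (i : Fin (k + 1)) :
    realize (affComp (face i σ)) k (subdiv tupleBarycenter k (Finsupp.single vertex 1)) =
      realize (affComp σ) k (subdiv tupleBarycenter k (Finsupp.single (vertex ∘ i.succAbove) 1)) := by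
  rw [face_eq_affComp, realize_push (affMap (vertex ∘ i.succAbove)) (affComp_affComp σ _), push_affMap_subdiv,
    push_single, affMap_comp_vertex]

theorem boundary_sd (k : ℕ) (c : SingChain X (k + 1)) :
    boundary X k (sd X (k + 1) c) = sd X k (boundary X k c) := by
  have : boundary X k ∘ₗ sd X (k + 1) = sd X k ∘ₗ boundary X k := by
    refine hom_ext fun σ => ?_
    rw [LinearMap.comp_apply, LinearMap.comp_apply, sd_single, boundary_realize (face_affComp σ),
      bdry_subdiv, bdry_single, boundary_single]
    simp only [map_sum, map_smul, sd_single, realize_affComp_face_subdiv]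
  exact LinearMap.congr_fun this c

/-- The formula holds for the tuple of vertices by `bdry_coneHomotopy`. Realization carries it over,
and naturality under the face inclusions matches the last term. -/
theorem boundary_sdHomotopy (k : ℕ) (c : SingChain X (k + 1)) :
    boundary X (k + 1) (sdHomotopy X (k + 1) c) =
      c - sd X (k + 1) c - sdHomotopy X k (boundary X k c) := by
  have : boundary X (k + 1) ∘ₗ sdHomotopy X (k + 1) =
      LinearMap.id - sd X (k + 1) - sdHomotopy X k ∘ₗ boundary X k := by
    refine hom_ext fun σ => ?_
    rw [LinearMap.comp_apply, sdHomotopy_single, boundary_realize (face_affComp σ),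
      bdry_coneHomotopy (α := fun _ => LinearMap.id) (fun _ _ => rfl) (bdry_subdiv _) rfl, LinearMap.sub_apply,
      LinearMap.sub_apply, LinearMap.comp_apply, sd_single, bdry_single, boundary_single]
    simp only [map_sum, map_sub, map_smul, sdHomotopy_single, LinearMap.id_apply, realize_single,
      affComp_vertex]
    congr 1
    refine Finset.sum_congr rfl fun i _ => ?_
    congr 1
    symm
    rw [face_eq_affComp, realize_push (affMap (vertex ∘ i.succAbove)) (affComp_affComp σ _),
      push_coneHomotopy (α := fun _ => LinearMap.id) (α' := fun _ => LinearMap.id)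
        (fun _ _ => rfl) (push_affMap_subdiv _) (affMap_tupleBarycenter _), push_single,
      affMap_comp_vertex]
  exact LinearMap.congr_fun this c

/-- The time `v` of a homotopy. -/
def _root_.ContinuousMap.sliceRight {T : Type*} [TopologicalSpace T] (h : C(X × T, Y)) (v : T) :
    C(X, Y) :=
  h.comp ((ContinuousMap.id X).prodMk (ContinuousMap.const X v))

theorem realize_prismComp_push (h : C(X × stdSimplex ℝ (Fin 2), Y)) (k : ℕ) (σ : SingSimplex X k)
    (v : stdSimplex ℝ (Fin 2)) :
    realize (prismComp h σ) k (push (fun p => (p, v)) k (Finsupp.single vertex 1)) =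
      Finsupp.single ((h.sliceRight v).comp σ) 1 := by
  rw [push_single, realize_single]
  congr 1
  have h1 := affMap_const (ι := Fin k) v
  have h2 := affComp_vertex σ
  rw [prismComp]
  simp only [Function.comp_def] at h2 ⊢
  rw [h1, h2]
  rfl

/-- In the convex prism, any point can serve as apex. Coning from the first vertex at time 0 joins
the top copy of the simplex to the bottom one. -/
theorem boundary_prism (h : C(X × stdSimplex ℝ (Fin 2), Y)) (k : ℕ) (σ : SingSimplex X (k + 1)) :
    boundary Y (k + 1) (prism h (k + 1) (Finsupp.single σ 1)) =
      Finsupp.single ((h.sliceRight (vertex 1)).comp σ) 1 -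
        Finsupp.single ((h.sliceRight (vertex 0)).comp σ) 1 -
          prism h k (boundary X k (Finsupp.single σ 1)) := by
  rw [prism_single, boundary_realize (face_prismComp h σ), bdry_coneHomotopy
      (fun _ _ => (push_bdry _ _ _).symm) (fun _ _ => (push_bdry _ _ _).symm), map_sub, map_sub,
      realize_prismComp_push, realize_prismComp_push, bdry_single, boundary_single]
  · simp only [map_sum, map_smul, prism_single]
    congr 1
    refine Finset.sum_congr rfl fun i _ => ?_
    congr 1
    symm
    rw [face_eq_affComp, realize_push (Prod.map (affMap (vertex ∘ i.succAbove)) id) (prismComp_affComp h σ _),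
      push_coneHomotopy (g := affMap (vertex ∘ i.succAbove))
        (α' := push fun p => (p, vertex 1)) (β' := push fun p => (p, vertex 0))
        (b' := fun _ w => (w 0, vertex 0)), push_single, affMap_comp_vertex]
    · intro k c
      refine LinearMap.congr_fun (f := push _ k ∘ₗ push _ k) (g := push _ k ∘ₗ push _ k)
        (TupleChain.hom_ext fun w => ?_) c
      simp only [LinearMap.comp_apply, push_single]
      rfl
    · intro k c
      refine LinearMap.congr_fun (f := push _ k ∘ₗ push _ k) (g := push _ k ∘ₗ push _ k)
        (TupleChain.hom_ext fun w => ?_) c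
      simp only [LinearMap.comp_apply, push_single]
      rfl
    · intro k w
      rfl
  -- The two ends agree on the empty tuple because there is only one such tuple.
  · refine TupleChain.hom_ext fun w => ?_
    rw [push_single, push_single]
    congr 1
    exact Subsingleton.elim _ _

/-- With zero vertices the operator vanishes, so the augmentation contributes nothing to the
homotopy formula in cochain degree zero. -/
theorem prism_zero (h : C(X × stdSimplex ℝ (Fin 2), Y)) : prism h 0 = 0 :=
  hom_ext fun σ => by rw [prism_single]; simp [coneHomotopy]

end SingChain

open stdSimplex

/-! ### Iterated subdivision makes simplices small -/

theorem Finsupp.map_mem_of_mem_supported {α M : Type*} [AddCommGroup M] {s : Set α}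
    {f : (α →₀ ℤ) →ₗ[ℤ] M} {N : Submodule ℤ M} (h : ∀ a ∈ s, f (Finsupp.single a 1) ∈ N)
    {c : α →₀ ℤ} (hc : c ∈ Finsupp.supported ℤ ℤ s) : f c ∈ N := by
  rw [Finsupp.supported_eq_span_single] at hc
  refine (Submodule.span_le (p := N.comap f)).2 ?_ hc
  rintro _ ⟨a, ha, rfl⟩
  exact h a ha

namespace stdSimplex

variable {ι κ : Type*} [Fintype ι] [Fintype κ]

/-- Values of `affMap w` are convex combinations of the `w i`, and balls of the supremum metric are
convex. -/
theorem dist_affMap_le {p : stdSimplex ℝ κ} {w : ι → stdSimplex ℝ κ} {r : ℝ} (hr : 0 ≤ r)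
    (h : ∀ i, dist p (w i) ≤ r) (t : stdSimplex ℝ ι) : dist p (affMap w t) ≤ r := by
  rw [Subtype.dist_eq, dist_pi_le_iff hr]
  intro x
  have h1 : p x - affMap w t x = ∑ i, t i * (p x - w i x) := by
    simp only [mul_sub, Finset.sum_sub_distrib, ← Finset.sum_mul, sum_eq_one, one_mul, affMap_apply]
  have h2 : |p x - affMap w t x| ≤ r := by
    rw [h1]
    calc |∑ i, t i * (p x - w i x)| ≤ ∑ i, |t i * (p x - w i x)| := Finset.abs_sum_le_sum_abs _ _
      _ ≤ ∑ i, t i * r := by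
        refine Finset.sum_le_sum fun i _ => ?_
        rw [abs_mul, abs_of_nonneg (zero_le t i)]
        refine mul_le_mul_of_nonneg_left ?_ (zero_le t i)
        exact (dist_le_pi_dist p.1 (w i).1 x).trans (h i)
      _ = r := by rw [← Finset.sum_mul, sum_eq_one, one_mul]
  exact h2

/-- The difference is the average of the `k + 1` vectors `w i - w j`; the one with `i = j` is zero,
which leaves `k` terms of size at most `D / (k + 1)`. -/
theorem dist_tupleBarycenter_le {k : ℕ} {w : Fin (k + 1) → stdSimplex ℝ κ} {D : ℝ} (hD : 0 ≤ D)
    (h : ∀ i j, dist (w i) (w j) ≤ D) (j : Fin (k + 1)) :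
    dist (tupleBarycenter k w) (w j) ≤ k / (k + 1) * D := by
  rw [Subtype.dist_eq, dist_pi_le_iff (by positivity)]
  intro x
  have h1 : tupleBarycenter k w x - w j x =
      ∑ i ∈ Finset.univ.erase j, ((k : ℝ) + 1)⁻¹ * (w i x - w j x) := by
    rw [Finset.sum_erase _ (by simp)]
    simp only [mul_sub, Finset.sum_sub_distrib]
    rw [Finset.sum_const, Finset.card_univ, Fintype.card_fin, nsmul_eq_mul]
    push_cast
    rw [mul_inv_cancel_left₀ (by positivity)]
    rfl
  have h2 : |tupleBarycenter k w x - w j x| ≤ k / (k + 1) * D := by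
    rw [h1]
    calc _ ≤ ∑ i ∈ Finset.univ.erase j, |((k : ℝ) + 1)⁻¹ * (w i x - w j x)| :=
          Finset.abs_sum_le_sum_abs _ _
      _ ≤ ∑ i ∈ Finset.univ.erase j, ((k : ℝ) + 1)⁻¹ * D := by
        refine Finset.sum_le_sum fun i _ => ?_
        rw [abs_mul, abs_of_nonneg (by positivity)]
        refine mul_le_mul_of_nonneg_left ?_ (by positivity)
        exact (dist_le_pi_dist (w i).1 (w j).1 x).trans (h i j)
      _ = k / (k + 1) * D := by
        rw [Finset.sum_const, Finset.card_erase_of_mem (Finset.mem_univ j), Finset.card_univ,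
          Fintype.card_fin, nsmul_eq_mul, Nat.add_sub_cancel]
        ring
  exact h2

end stdSimplex

namespace TupleChain

variable {κ : Type*} [Fintype κ]

/-- The tuples of diameter at most `D`. -/
def fine (κ : Type*) [Fintype κ] (k : ℕ) (D : ℝ) : Set (Fin k → stdSimplex ℝ κ) :=
  {u | ∀ i j, dist (u i) (u j) ≤ D}

/-- Faces of lower dimension contract even faster, so the single factor `N / (N + 1)` serves all `k
≤ N + 1` and the induction closes. The range condition is carried along because it bounds the
distance from the new barycenter to the points of a subdivided face. -/
theorem subdiv_single_mem_supported (N : ℕ) {D : ℝ} (hD : 0 ≤ D) :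
    ∀ (k : ℕ) (_ : k ≤ N + 1) (w : Fin k → stdSimplex ℝ κ) (_ : w ∈ fine κ k D),
    subdiv tupleBarycenter k (Finsupp.single w 1) ∈
      Finsupp.supported ℤ ℤ {u | (∀ i, u i ∈ Set.range (affMap w)) ∧ u ∈ fine κ k (N / (N + 1) * D)}
  | 0, _, w, _ => by
    rw [Finsupp.mem_supported]
    exact fun u _ => ⟨fun i => i.elim0, fun i => i.elim0⟩
  | k + 1, hk, w, hw => by
    have hr : (0 : ℝ) ≤ N / (N + 1) * D := by positivity
    have hkN : (k : ℝ) / (k + 1) ≤ N / (N + 1) := by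
      have : (k : ℝ) ≤ N := by exact_mod_cast Nat.le_of_succ_le_succ hk
      rw [div_le_div_iff₀ (by positivity) (by positivity)]
      nlinarith
    rw [subdiv_single, bdry_single, map_sum, map_sum]
    refine Submodule.sum_mem _ fun i _ => ?_
    rw [map_smul, map_smul]
    refine Submodule.smul_mem _ _ ?_
    refine Finsupp.map_mem_of_mem_supported (fun u hu => ?_)
      (subdiv_single_mem_supported N hD k (Nat.le_of_succ_le hk) (w ∘ i.succAbove)
        fun a b => hw _ _)
    rw [cone_single]
    refine Finsupp.single_mem_supported ℤ _ ⟨fun a => ?_, ?_⟩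
    · refine Fin.cases ?_ (fun a => ?_) a
      · exact ⟨_, rfl⟩
      · obtain ⟨t, ht⟩ := hu.1 a
        refine ⟨affMap (vertex ∘ i.succAbove) t, ?_⟩
        rw [affMap_affMap, ← Function.comp_assoc, affMap_comp_vertex, ht, Fin.cons_succ]
    · have hb : ∀ a, dist (tupleBarycenter k w) (u a) ≤ N / (N + 1) * D := by
        intro a
        obtain ⟨t, ht⟩ := hu.1 a
        rw [← ht]
        exact dist_affMap_le hr (fun j => (dist_tupleBarycenter_le hD hw _).trans
          (mul_le_mul_of_nonneg_right hkN hD)) t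
      intro a b
      refine Fin.cases ?_ (fun a => ?_) a
      · refine Fin.cases ?_ (fun b => ?_) b
        · simpa using hr
        · simpa using hb b
      · refine Fin.cases ?_ (fun b => ?_) b
        · rw [dist_comm]
          simpa using hb a
        · simpa using hu.2 a b

theorem iterate_subdiv_mem_supported {k : ℕ} {D : ℝ} (hD : 0 ≤ D)
    {c : TupleChain (stdSimplex ℝ κ) (k + 1)} (hc : c ∈ Finsupp.supported ℤ ℤ (fine κ (k + 1) D))
    (n : ℕ) : (subdiv tupleBarycenter (k + 1))^[n] c ∈
      Finsupp.supported ℤ ℤ (fine κ (k + 1) (((k : ℝ) / (k + 1)) ^ n * D)) := by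
  induction n with
  | zero => simpa using hc
  | succ n ih =>
    rw [Function.iterate_succ_apply']
    refine Finsupp.map_mem_of_mem_supported (fun w hw => ?_) ih
    refine Finsupp.supported_mono ?_ (subdiv_single_mem_supported k (by positivity) _ le_rfl w hw)
    intro u hu
    rw [pow_succ', mul_assoc]
    exact hu.2

end TupleChain

namespace SingChain

open SingSimplex TupleChain

variable {X : Type*} [TopologicalSpace X]

theorem sd_realize {m : ℕ} (σ : SingSimplex X m) (k : ℕ)
    (c : TupleChain (stdSimplex ℝ (Fin m)) k) :
    sd X k (realize (affComp σ) k c) = realize (affComp σ) k (subdiv tupleBarycenter k c) := by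
  have : sd X k ∘ₗ realize (affComp σ) k = realize (affComp σ) k ∘ₗ subdiv tupleBarycenter k := by
    refine TupleChain.hom_ext fun w => ?_
    rw [LinearMap.comp_apply, realize_single, sd_single, LinearMap.comp_apply,
      realize_push (affMap w) (affComp_affComp σ _), push_affMap_subdiv, push_single,
      affMap_comp_vertex]
  exact LinearMap.congr_fun this c

theorem iterate_sd_single {k : ℕ} (σ : SingSimplex X k) (n : ℕ) :
    (sd X k)^[n] (Finsupp.single σ 1) =
      realize (affComp σ) k ((subdiv tupleBarycenter k)^[n] (Finsupp.single vertex 1)) := by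
  induction n with
  | zero => simp
  | succ n ih => rw [Function.iterate_succ_apply', ih, sd_realize, Function.iterate_succ_apply']

/-- A sufficiently fine subdivision of a singular simplex in the union of two open sets consists
of simplices each of which lies in one of the two sets. -/
theorem exists_iterate_sd_mem_supported {U V : Set X} (hU : IsOpen U) (hV : IsOpen V) {k : ℕ}
    (σ : SingSimplex X (k + 1)) (hσ : Set.range σ ⊆ U ∪ V) :
    ∃ m, ∀ n ≥ m, (sd X (k + 1))^[n] (Finsupp.single σ 1) ∈
      Finsupp.supported ℤ ℤ {τ : SingSimplex X (k + 1) | Set.range τ ⊆ U ∨ Set.range τ ⊆ V} := by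
  have hc : IsCompact (Set.univ : Set (stdSimplex ℝ (Fin (k + 1)))) := isCompact_univ
  -- With a Lebesgue number `δ` for the preimages of `U` and `V`, an affine simplex of diameter less
  -- than `δ` lies in a ball that one of them contains.
  obtain ⟨δ, hδ, h⟩ := lebesgue_number_lemma_of_metric (ι := Bool)
    (c := fun b => σ ⁻¹' (if b then U else V)) hc
    (fun b => (by cases b <;> simpa : IsOpen (if b then U else V)).preimage σ.continuous)
    (fun t _ => by
      rcases hσ ⟨t, rfl⟩ with h | h
      · exact Set.mem_iUnion.2 ⟨true, h⟩
      · exact Set.mem_iUnion.2 ⟨false, h⟩)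
  obtain ⟨D, hD0, hD⟩ : ∃ D : ℝ, 0 ≤ D ∧
      (vertex : Fin (k + 1) → stdSimplex ℝ (Fin (k + 1))) ∈ fine (Fin (k + 1)) (k + 1) D := by
    refine ⟨Metric.diam (Set.univ : Set (stdSimplex ℝ (Fin (k + 1)))), Metric.diam_nonneg, ?_⟩
    exact fun i j => Metric.dist_le_diam_of_mem hc.isBounded trivial trivial
  have hlt : (k : ℝ) / (k + 1) < 1 := by
    rw [div_lt_one (by positivity)]
    exact lt_add_one _
  have hlim := (tendsto_pow_atTop_nhds_zero_of_lt_one (by positivity) hlt).mul_const D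
  rw [zero_mul] at hlim
  obtain ⟨m, hm⟩ := Filter.eventually_atTop.1 (hlim.eventually_lt_const hδ)
  refine ⟨m, fun n hn => ?_⟩
  rw [iterate_sd_single]
  refine realize_mem_supported (fun w hw => ?_) (iterate_subdiv_mem_supported hD0
    (Finsupp.single_mem_supported ℤ _ hD) n)
  have hsub : ∀ t, affMap w t ∈ Metric.ball (w 0) δ := by
    intro t
    rw [Metric.mem_ball, dist_comm]
    exact (dist_affMap_le (by positivity) (fun i => hw 0 i) t).trans_lt (hm n hn)
  obtain ⟨b, hb⟩ := h (w 0) trivial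
  have hr : Set.range (σ.affComp (k + 1) w) ⊆ if b then U else V := by
    rintro _ ⟨t, rfl⟩
    exact hb (hsub t)
  cases b
  · exact Or.inr (by simpa using hr)
  · exact Or.inl (by simpa using hr)

end SingChain

universe u

open stdSimplex

/-! ### Relative cochains of families of simplices -/

/-- A family of singular simplices of a space closed under taking faces. -/
structure SimplexFamily (X : Type u) [TopologicalSpace X] where
  carrier : ∀ n : ℕ, Set (SingSimplex X (n + 1))
  face_mem : ∀ {n : ℕ} (i : Fin (n + 2)) {σ : SingSimplex X (n + 2)},
    σ ∈ carrier (n + 1) → SingSimplex.face i σ ∈ carrier n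

namespace SimplexFamily

variable {X : Type u} [TopologicalSpace X]

/-- The singular simplices contained in a subset. -/
def of (S : Set X) : SimplexFamily X where
  carrier _ := {σ | Set.range σ ⊆ S}
  face_mem _ σ h := (Set.range_comp_subset_range _ σ).trans h

/-- The singular simplices contained in one of two subsets. -/
def ofEither (S T : Set X) : SimplexFamily X where
  carrier _ := {σ | Set.range σ ⊆ S ∨ Set.range σ ⊆ T}
  face_mem _ σ h := Or.imp (Set.range_comp_subset_range _ σ).trans
    (Set.range_comp_subset_range _ σ).trans h

end SimplexFamily

section cochains

variable {X Y Z : Type u} [TopologicalSpace X] [TopologicalSpace Y] [TopologicalSpace Z]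

open SingSimplex SingChain

/-- The coboundary of a singular cochain. -/
def coboundary {k : ℕ} (f : SingSimplex X k → ℤ) (σ : SingSimplex X (k + 1)) : ℤ :=
  ∑ i : Fin (k + 1), (-1) ^ (i : ℕ) * f (face i σ)

/-- The value of a cochain on a chain. -/
def evalChain {k : ℕ} (f : SingSimplex X k → ℤ) : SingChain X k →ₗ[ℤ] ℤ :=
  Finsupp.linearCombination ℤ f

@[simp]
theorem evalChain_single {k : ℕ} (f : SingSimplex X k → ℤ) (σ : SingSimplex X k) :
    evalChain f (Finsupp.single σ 1) = f σ := by
  simp [evalChain]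

theorem evalChain_boundary {k : ℕ} (f : SingSimplex X k → ℤ) (c : SingChain X (k + 1)) :
    evalChain f (boundary X k c) = evalChain (coboundary f) c := by
  have : evalChain f ∘ₗ boundary X k = evalChain (coboundary f) := by
    refine SingChain.hom_ext fun σ => ?_
    simp only [LinearMap.comp_apply, boundary_single, map_sum, map_smul, evalChain_single,
      coboundary, smul_eq_mul]
  exact LinearMap.congr_fun this c

theorem evalChain_congr {k : ℕ} {f g : SingSimplex X k → ℤ} {s : Set (SingSimplex X k)}
    (h : ∀ σ ∈ s, f σ = g σ) {c : SingChain X k} (hc : c ∈ Finsupp.supported ℤ ℤ s) :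
    evalChain f c = evalChain g c := by
  have := Finsupp.map_mem_of_mem_supported (f := evalChain f - evalChain g) (N := ⊥)
    (fun σ hσ => by simp [h σ hσ]) hc
  simpa [sub_eq_zero] using this

theorem evalChain_eq_zero {k : ℕ} {f : SingSimplex X k → ℤ} {s : Set (SingSimplex X k)}
    (h : ∀ σ ∈ s, f σ = 0) {c : SingChain X k} (hc : c ∈ Finsupp.supported ℤ ℤ s) :
    evalChain f c = 0 := by
  simpa using Finsupp.map_mem_of_mem_supported (f := evalChain f) (N := ⊥)
    (fun σ hσ => by simp [h σ hσ]) hc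

theorem coboundary_coboundary {k : ℕ} (f : SingSimplex X k → ℤ) :
    coboundary (coboundary f) = 0 := by
  funext σ
  rw [← evalChain_single (coboundary (coboundary f)), ← evalChain_boundary, ← evalChain_boundary,
    boundary_boundary, map_zero, Pi.zero_apply]

/-- The cochains that vanish off the family `P` and on the family `Q`. -/
def relCochain (P Q : SimplexFamily X) (n : ℕ) : Submodule ℤ (SingSimplex X (n + 1) → ℤ) where
  carrier := {f | (∀ σ ∉ P.carrier n, f σ = 0) ∧ ∀ σ ∈ Q.carrier n, f σ = 0}
  add_mem' ha hb := ⟨fun σ h => by simp [ha.1 σ h, hb.1 σ h], fun σ h => by simp [ha.2 σ h, hb.2 σ h]⟩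
  zero_mem' := ⟨fun _ _ => rfl, fun _ _ => rfl⟩
  smul_mem' c f hf := ⟨fun σ h => by simp [hf.1 σ h], fun σ h => by simp [hf.2 σ h]⟩

open Classical in
/-- The coboundary of relative cochains. -/
def relCoboundary (P Q : SimplexFamily X) (n : ℕ) : relCochain P Q n →ₗ[ℤ] relCochain P Q (n + 1) where
  -- A simplex outside `P` may have faces in `P`, so the coboundary has to be cut off. On `P` the
  -- cut-off is invisible, since `P` is closed under faces.
  toFun f := ⟨fun σ => if σ ∈ P.carrier (n + 1) then coboundary f.1 σ else 0,
    fun σ h => by simp [h], fun σ h => by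
      have : coboundary f.1 σ = 0 :=
        Finset.sum_eq_zero fun i _ => by rw [f.2.2 _ (Q.face_mem i h), mul_zero]
      simp [this]⟩
  map_add' f g := by
    ext σ
    by_cases h : σ ∈ P.carrier (n + 1) <;> simp [h, coboundary, mul_add, Finset.sum_add_distrib]
  map_smul' c f := by
    ext σ
    by_cases h : σ ∈ P.carrier (n + 1)
    · simp only [h, coboundary, if_true, RingHom.id_apply, SetLike.val_smul, Pi.smul_apply,
        smul_eq_mul, Finset.mul_sum]
      exact Finset.sum_congr rfl fun i _ => mul_left_comm _ _ _
    · simp [h]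

variable {P Q R : SimplexFamily X} {P' Q' : SimplexFamily Y} {P'' Q'' : SimplexFamily Z}

theorem relCoboundary_apply {n : ℕ} (f : relCochain P Q n) {σ : SingSimplex X (n + 2)}
    (h : σ ∈ P.carrier (n + 1)) : (relCoboundary P Q n f).1 σ = coboundary f.1 σ := if_pos h

theorem relCochain_ext {n : ℕ} {f g : relCochain P Q n}
    (h : ∀ σ ∈ P.carrier n, f.1 σ = g.1 σ) : f = g := by
  ext σ
  by_cases hσ : σ ∈ P.carrier n
  · exact h σ hσ
  · rw [f.2.1 σ hσ, g.2.1 σ hσ]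

theorem relCoboundary_relCoboundary (n : ℕ) (f : relCochain P Q n) :
    relCoboundary P Q (n + 1) (relCoboundary P Q n f) = 0 := by
  refine relCochain_ext fun σ hσ => ?_
  rw [relCoboundary_apply _ hσ]
  have := congrFun (coboundary_coboundary f.1) σ
  rw [coboundary] at this
  rw [coboundary, Finset.sum_congr rfl fun i _ => by rw [relCoboundary_apply _ (P.face_mem i hσ)],
    this]
  rfl

/-- The relative singular cochain complex of a pair of families of simplices. -/
def relComplex (P Q : SimplexFamily X) : CochainComplex (ModuleCat.{u} ℤ) ℕ :=
  CochainComplex.of (fun n => ModuleCat.of ℤ (relCochain P Q n))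
    (fun n => ModuleCat.ofHom (relCoboundary P Q n)) fun n => by
      ext f : 2
      exact relCoboundary_relCoboundary n f

theorem relComplex_d (P Q : SimplexFamily X) (n : ℕ) :
    (relComplex P Q).d n (n + 1) = ModuleCat.ofHom (relCoboundary P Q n) :=
  CochainComplex.of_d (fun n => ModuleCat.of ℤ (relCochain P Q n))
    (fun n => ModuleCat.ofHom (relCoboundary P Q n)) n

open Classical in
/-- The pullback of relative cochains along a map. -/
def relPullback (φ : C(X, Y)) (hQ : ∀ n, ∀ σ ∈ Q.carrier n, φ.comp σ ∈ Q'.carrier n) (n : ℕ) :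
    relCochain P' Q' n →ₗ[ℤ] relCochain P Q n where
  toFun f := ⟨fun σ => if σ ∈ P.carrier n then f.1 (φ.comp σ) else 0, fun σ h => by simp [h],
    fun σ h => by simp [f.2.2 _ (hQ n σ h)]⟩
  map_add' f g := by
    ext σ
    by_cases h : σ ∈ P.carrier n <;> simp [h]
  map_smul' c f := by
    ext σ
    by_cases h : σ ∈ P.carrier n <;> simp [h]

theorem relPullback_apply (φ : C(X, Y)) (hQ : ∀ n, ∀ σ ∈ Q.carrier n, φ.comp σ ∈ Q'.carrier n)
    (n : ℕ) (f : relCochain P' Q' n) {σ : SingSimplex X (n + 1)} (h : σ ∈ P.carrier n) :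
    (relPullback (P := P) φ hQ n f).1 σ = f.1 (φ.comp σ) := if_pos h

/-- The map of relative cochain complexes induced by a map of pairs. -/
def relMap (φ : C(X, Y)) (hP : ∀ n, ∀ σ ∈ P.carrier n, φ.comp σ ∈ P'.carrier n)
    (hQ : ∀ n, ∀ σ ∈ Q.carrier n, φ.comp σ ∈ Q'.carrier n) :
    relComplex P' Q' ⟶ relComplex P Q :=
  CochainComplex.ofHom (X := relComplex P' Q') (Y := relComplex P Q)
    (fun n => ModuleCat.ofHom (relPullback φ hQ n)) fun n => by
    rw [relComplex_d, relComplex_d]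
    refine ModuleCat.hom_ext (LinearMap.ext fun (f : relCochain P' Q' n) => ?_)
    refine relCochain_ext fun σ hσ => ?_
    have h1 := relCoboundary_apply (relPullback (P := P) φ hQ n f) hσ
    have h2 := relPullback_apply (P := P) φ hQ (n + 1) (relCoboundary P' Q' n f) hσ
    rw [relCoboundary_apply _ (hP _ _ hσ)] at h2
    refine h1.trans (Eq.trans ?_ h2.symm)
    refine Finset.sum_congr rfl fun i _ => ?_
    rw [relPullback_apply _ _ _ _ (P.face_mem i hσ), comp_face]

theorem relMap_apply (φ : C(X, Y)) (hP : ∀ n, ∀ σ ∈ P.carrier n, φ.comp σ ∈ P'.carrier n)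
    (hQ : ∀ n, ∀ σ ∈ Q.carrier n, φ.comp σ ∈ Q'.carrier n) (n : ℕ) (f : relCochain P' Q' n)
    {σ : SingSimplex X (n + 1)} (h : σ ∈ P.carrier n) :
    ((relMap φ hP hQ).f n f : relCochain P Q n).1 σ = f.1 (φ.comp σ) :=
  relPullback_apply φ hQ n f h

theorem relMap_comp (φ : C(X, Y)) (hP : ∀ n, ∀ σ ∈ P.carrier n, φ.comp σ ∈ P'.carrier n)
    (hQ : ∀ n, ∀ σ ∈ Q.carrier n, φ.comp σ ∈ Q'.carrier n)
    (ψ : C(Y, Z)) (hP' : ∀ n, ∀ σ ∈ P'.carrier n, ψ.comp σ ∈ P''.carrier n)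
    (hQ' : ∀ n, ∀ σ ∈ Q'.carrier n, ψ.comp σ ∈ Q''.carrier n) :
    relMap ψ hP' hQ' ≫ relMap φ hP hQ =
      relMap (ψ.comp φ) (fun n σ h => hP' n _ (hP n σ h)) (fun n σ h => hQ' n _ (hQ n σ h)) := by
  ext n f : 3
  refine relCochain_ext fun σ hσ => ?_
  exact (relMap_apply φ hP hQ n _ hσ).trans ((relMap_apply ψ hP' hQ' n f (hP n σ hσ)).trans
    (relMap_apply (P := P) (ψ.comp φ) _ (fun n σ h => hQ' n _ (hQ n σ h)) n f hσ).symm)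

theorem relMap_eq_id (φ : C(X, X)) (h : ∀ x, φ x = x)
    (hP : ∀ n, ∀ σ ∈ P.carrier n, φ.comp σ ∈ P.carrier n)
    (hQ : ∀ n, ∀ σ ∈ Q.carrier n, φ.comp σ ∈ Q.carrier n) :
    relMap φ hP hQ = 𝟙 (relComplex P Q) := by
  obtain rfl : φ = ContinuousMap.id X := ContinuousMap.ext h
  ext n f : 3
  exact relCochain_ext fun σ hσ => relMap_apply _ hP hQ n f hσ

theorem relMap_eq_zero (φ : C(X, Y)) (hP : ∀ n, ∀ σ ∈ P.carrier n, φ.comp σ ∈ P'.carrier n)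
    (hQ : ∀ n, ∀ σ ∈ Q.carrier n, φ.comp σ ∈ Q'.carrier n)
    (h : ∀ n, ∀ σ ∈ P.carrier n, φ.comp σ ∈ Q'.carrier n) :
    relMap φ hP hQ = 0 := by
  ext n f : 3
  exact relCochain_ext fun σ hσ => (relMap_apply _ hP hQ n f hσ).trans (f.2.2 _ (h n σ hσ))

/-- A map of pairs that is bijective on the simplices of `P` outside `Q` induces an isomorphism
of relative cochain complexes. -/
theorem isIso_relMap (φ : C(X, Y)) (hP : ∀ n, ∀ σ ∈ P.carrier n, φ.comp σ ∈ P'.carrier n)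
    (hQ : ∀ n, ∀ σ ∈ Q.carrier n, φ.comp σ ∈ Q'.carrier n)
    (hinj : Function.Injective φ)
    (hQ' : ∀ n, ∀ σ ∈ P.carrier n, φ.comp σ ∈ Q'.carrier n → σ ∈ Q.carrier n)
    (hlift : ∀ n, ∀ τ ∈ P'.carrier n, τ ∉ Q'.carrier n → ∃ σ ∈ P.carrier n, φ.comp σ = τ) :
    IsIso (relMap φ hP hQ) := by
  classical
  have hinj' : ∀ {n} {σ τ : SingSimplex X n}, φ.comp σ = φ.comp τ → σ = τ := fun h =>
    ContinuousMap.ext fun t => hinj (DFunLike.congr_fun h t)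
  have : ∀ n, IsIso ((relMap φ hP hQ).f n) := by
    intro n
    rw [ConcreteCategory.isIso_iff_bijective]
    constructor
    · intro f g hfg
      refine relCochain_ext fun τ hτ => ?_
      by_cases hτQ : τ ∈ Q'.carrier n
      · rw [f.2.2 τ hτQ, g.2.2 τ hτQ]
      · obtain ⟨σ, hσ, rfl⟩ := hlift n τ hτ hτQ
        have := congrFun (congrArg Subtype.val hfg) σ
        exact (relMap_apply φ hP hQ n f hσ).symm.trans
          (this.trans (relMap_apply φ hP hQ n g hσ))
    · intro g
      -- The preimage of `g` is its transport along chosen lifts, extended by zero. Injectivity of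
      -- `φ` makes the lift unique.
      let e : SingSimplex Y (n + 1) → ℤ := fun τ =>
        if h : ∃ σ ∈ P.carrier n, φ.comp σ = τ then g.1 h.choose else 0
      have he : ∀ σ ∈ P.carrier n, e (φ.comp σ) = g.1 σ := by
        intro σ hσ
        have h : ∃ σ' ∈ P.carrier n, φ.comp σ' = φ.comp σ := ⟨σ, hσ, rfl⟩
        simp only [e, dif_pos h]
        rw [hinj' h.choose_spec.2]
      refine ⟨(⟨e, fun τ hτ => ?_, fun τ hτ => ?_⟩ : relCochain P' Q' n), ?_⟩
      · refine dif_neg ?_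
        rintro ⟨σ, hσ, rfl⟩
        exact hτ (hP n σ hσ)
      · by_cases h : ∃ σ ∈ P.carrier n, φ.comp σ = τ
        · obtain ⟨σ, hσ, rfl⟩ := h
          rw [he σ hσ, g.2.2 σ (hQ' n σ hσ hτ)]
        · exact dif_neg h
      · exact relCochain_ext fun σ hσ => (relMap_apply φ hP hQ n _ hσ).trans (he σ hσ)
  exact HomologicalComplex.Hom.isIso_of_components _

/-- The short exact sequence of relative cochain complexes of a triple. -/
theorem exists_shortExact_relComplex (hRQ : ∀ n, R.carrier n ⊆ Q.carrier n)
    (hQP : ∀ n, Q.carrier n ⊆ P.carrier n) :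
    ∃ (f : relComplex P Q ⟶ relComplex P R) (g : relComplex P R ⟶ relComplex Q R) (w : f ≫ g = 0),
      (ShortComplex.mk f g w).ShortExact := by
  classical
  let f : relComplex P Q ⟶ relComplex P R :=
    relMap (ContinuousMap.id X) (fun _ _ h => h) (fun n σ h => hRQ n h)
  let g : relComplex P R ⟶ relComplex Q R :=
    relMap (ContinuousMap.id X) (fun n σ h => hQP n h) (fun _ _ h => h)
  have hf : ∀ n (x : relCochain P Q n), (f.f n x : relCochain P R n).1 = x.1 := by
    intro n x
    funext σ
    by_cases hσ : σ ∈ P.carrier n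
    · exact relMap_apply _ _ _ n x hσ
    · exact ((f.f n x : relCochain P R n).2.1 σ hσ).trans (x.2.1 σ hσ).symm
  have hg : ∀ n (x : relCochain P R n), ∀ σ ∈ Q.carrier n,
      (g.f n x : relCochain Q R n).1 σ = x.1 σ := fun n x σ hσ =>
    relMap_apply _ _ _ n x hσ
  have w : f ≫ g = 0 := by
    ext n x : 3
    refine relCochain_ext fun σ hσ => ?_
    exact (hg n _ σ hσ).trans ((congrFun (hf n x) σ).trans (x.2.2 σ hσ))
  refine ⟨f, g, w, ?_⟩
  refine HomologicalComplex.shortExact_of_degreewise_shortExact _ fun n => ?_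
  refine ModuleCat.shortComplex_shortExact _ ?_ ?_ ?_
  · intro y
    constructor
    · intro hy
      have hy' : ∀ σ ∈ Q.carrier n, (y : relCochain P R n).1 σ = 0 := fun σ hσ =>
        (hg n y σ hσ).symm.trans (congrFun (congrArg Subtype.val hy) σ)
      exact ⟨(⟨(y : relCochain P R n).1, (y : relCochain P R n).2.1, hy'⟩ : relCochain P Q n),
        Subtype.ext (hf n _)⟩
    · rintro ⟨x, rfl⟩
      exact relCochain_ext fun σ hσ =>
        (hg n _ σ hσ).trans ((congrFun (hf n x) σ).trans ((x : relCochain P Q n).2.2 σ hσ))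
  · intro x y hxy
    have := congrArg Subtype.val hxy
    exact Subtype.ext ((hf n x).symm.trans (this.trans (hf n y)))
  · intro y
    -- A cochain that vanishes off `Q` also vanishes off the larger family `P`, so it is its own
    -- extension.
    refine ⟨(⟨(y : relCochain Q R n).1, fun σ hσ => (y : relCochain Q R n).2.1 σ fun h =>
      hσ (hQP n h), (y : relCochain Q R n).2.2⟩ : relCochain P R n), ?_⟩
    exact relCochain_ext fun σ hσ => hg n _ σ hσ

end cochains

open stdSimplex

/-! ### Criteria for acyclicity and homotopy -/

theorem CochainComplex.isZero_homology_succ {K : CochainComplex (ModuleCat.{u} ℤ) ℕ} (n : ℕ)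
    (h : ∀ x : K.X (n + 1), K.d (n + 1) (n + 2) x = 0 → ∃ y : K.X n, K.d n (n + 1) y = x) :
    Limits.IsZero (K.homology (n + 1)) := by
  rw [← HomologicalComplex.exactAt_iff_isZero_homology,
    K.exactAt_iff' n (n + 1) (n + 2) (by simp) (by simp), ShortComplex.moduleCat_exact_iff]
  exact h

theorem CochainComplex.isZero_homology_of_exact {K : CochainComplex (ModuleCat.{u} ℤ) ℕ}
    (h0 : ∀ x : K.X 0, K.d 0 1 x = 0 → x = 0)
    (hs : ∀ n, ∀ x : K.X (n + 1), K.d (n + 1) (n + 2) x = 0 → ∃ y : K.X n, K.d n (n + 1) y = x)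
    (n : ℕ) : Limits.IsZero (K.homology n) := by
  rcases n with _ | n
  · rw [← HomologicalComplex.exactAt_iff_isZero_homology, K.exactAt_iff' 0 0 1 (by simp) (by simp),
      ShortComplex.moduleCat_exact_iff]
    exact fun x hx => ⟨0, by rw [map_zero]; exact (h0 x hx).symm⟩
  · exact isZero_homology_succ n (hs n)

/-- A chain homotopy of cochain complexes from its components. -/
def CochainComplex.mkHomotopy {K L : CochainComplex (ModuleCat.{u} ℤ) ℕ} (f g : K ⟶ L)
    (h : ∀ n, K.X (n + 1) ⟶ L.X n) (h0 : f.f 0 = K.d 0 1 ≫ h 0 + g.f 0)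
    (hs : ∀ n, f.f (n + 1) =
      K.d (n + 1) (n + 2) ≫ h (n + 1) + h n ≫ L.d n (n + 1) + g.f (n + 1)) : Homotopy f g where
  hom i j := if e : j + 1 = i then eqToHom (by rw [e]) ≫ h j else 0
  zero i j hij := dif_neg hij
  comm n := by
    rcases n with _ | n
    · rw [Homotopy.dNext_cochainComplex, Homotopy.prevD_zero_cochainComplex]
      simpa using h0
    · rw [Homotopy.dNext_cochainComplex, Homotopy.prevD_succ_cochainComplex]
      simpa using hs n

section

variable {X Y : Type u} [TopologicalSpace X] [TopologicalSpace Y]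

open SingSimplex SingChain

/-! ### Cochains vanishing on small simplices -/

section excision

variable {k : ℕ} {s : Set (SingSimplex X k)}

theorem SimplexFamily.sd_mem_supported (P : SimplexFamily X) (hP : ∀ {m n : ℕ}
    {σ : SingSimplex X (m + 1)}, σ ∈ P.carrier m → ∀ w, σ.affComp (n + 1) w ∈ P.carrier n)
    {n : ℕ} {c : SingChain X (n + 1)} (hc : c ∈ Finsupp.supported ℤ ℤ (P.carrier n)) :
    sd X (n + 1) c ∈ Finsupp.supported ℤ ℤ (P.carrier n) := by
  refine Finsupp.map_mem_of_mem_supported (fun σ hσ => ?_) hc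
  rw [sd_single]
  exact realize_mem_supported (t := Set.univ) (fun w _ => hP hσ w)
    (by rw [Finsupp.supported_univ]; trivial)

theorem SimplexFamily.sdHomotopy_mem_supported (P : SimplexFamily X) (hP : ∀ {m n : ℕ}
    {σ : SingSimplex X (m + 1)}, σ ∈ P.carrier m → ∀ w, σ.affComp (n + 1) w ∈ P.carrier n)
    {n : ℕ} {c : SingChain X (n + 1)} (hc : c ∈ Finsupp.supported ℤ ℤ (P.carrier n)) :
    sdHomotopy X (n + 1) c ∈ Finsupp.supported ℤ ℤ (P.carrier (n + 1)) := by
  refine Finsupp.map_mem_of_mem_supported (fun σ hσ => ?_) hc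
  rw [sdHomotopy_single]
  exact realize_mem_supported (t := Set.univ) (fun w _ => hP hσ w)
    (by rw [Finsupp.supported_univ]; trivial)

/-- The chain homotopy between the identity and an iterated barycentric subdivision. -/
def SingChain.iterSdHomotopy (X : Type u) [TopologicalSpace X] (m k : ℕ) :
    SingChain X k →ₗ[ℤ] SingChain X (k + 1) :=
  ∑ i ∈ Finset.range m, sdHomotopy X k ∘ₗ (sd X k) ^ i

theorem SingChain.boundary_sd_pow (k m : ℕ) (c : SingChain X (k + 1)) :
    boundary X k ((sd X (k + 1) ^ m) c) = (sd X k ^ m) (boundary X k c) := by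
  induction m with
  | zero => simp
  | succ m ih => rw [pow_succ', Module.End.mul_apply, boundary_sd, ih, pow_succ', Module.End.mul_apply]

theorem SingChain.boundary_iterSdHomotopy (k m : ℕ) (c : SingChain X (k + 1)) :
    boundary X (k + 1) (iterSdHomotopy X m (k + 1) c) =
      c - (sd X (k + 1) ^ m) c - iterSdHomotopy X m k (boundary X k c) := by
  simp only [iterSdHomotopy, LinearMap.sum_apply, LinearMap.comp_apply, map_sum,
    boundary_sdHomotopy, boundary_sd_pow, Finset.sum_sub_distrib]
  congr 1
  rw [← Finset.sum_sub_distrib]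
  have := Finset.sum_range_sub' (fun i => (sd X (k + 1) ^ i) c) m
  simp only [pow_succ', Module.End.mul_apply] at this
  simpa using this

theorem affComp_mem_of {S : Set X} {m n : ℕ} {σ : SingSimplex X (m + 1)}
    (hσ : σ ∈ (SimplexFamily.of S).carrier m) (w : Fin (n + 1) → stdSimplex ℝ (Fin (m + 1))) :
    σ.affComp (n + 1) w ∈ (SimplexFamily.of S).carrier n :=
  (Set.range_comp_subset_range _ σ).trans hσ

theorem affComp_mem_ofEither {S T : Set X} {m n : ℕ} {σ : SingSimplex X (m + 1)}
    (hσ : σ ∈ (SimplexFamily.ofEither S T).carrier m)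
    (w : Fin (n + 1) → stdSimplex ℝ (Fin (m + 1))) :
    σ.affComp (n + 1) w ∈ (SimplexFamily.ofEither S T).carrier n :=
  Or.imp (Set.range_comp_subset_range _ σ).trans (Set.range_comp_subset_range _ σ).trans hσ

/-- Cochains on the simplices of a union of two open sets that vanish on small simplices form an
acyclic complex. -/
theorem isZero_homology_of_union {U V : Set X} (hU : IsOpen U) (hV : IsOpen V) (n : ℕ) :
    Limits.IsZero
      ((relComplex (SimplexFamily.of (U ∪ V)) (SimplexFamily.ofEither U V)).homology n) := by
  classical
  set P := SimplexFamily.of (U ∪ V) with hPdef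
  set Q := SimplexFamily.ofEither U V with hQdef
  refine CochainComplex.isZero_homology_of_exact (fun (x : relCochain P Q 0) _ => ?_)
    (fun n (x : relCochain P Q (n + 1)) hx => ?_) n
  · refine relCochain_ext fun σ hσ => ?_
    refine (x.2.2 σ ?_).trans rfl
    -- A 0-simplex is a point, which lies in `U` or in `V`. All 0-simplices are therefore small and
    -- the cochain is zero.
    have hr : ∀ t, σ t = σ (vertex 0) := fun t => congrArg σ (Subsingleton.elim _ _)
    rcases hσ ⟨vertex 0, rfl⟩ with h | h
    · refine Or.inl ?_
      rintro _ ⟨t, rfl⟩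
      rwa [hr]
    · refine Or.inr ?_
      rintro _ ⟨t, rfl⟩
      rwa [hr]
  · have hx' : ∀ σ ∈ P.carrier (n + 2), coboundary x.1 σ = 0 := by
      intro σ hσ
      have h1 : relCoboundary P Q (n + 1) x = 0 := by
        rw [relComplex_d] at hx
        exact hx
      rw [← relCoboundary_apply x hσ, h1]
      rfl
    -- Each simplex has its own depth `m σ` beyond which all iterated subdivisions are small; no
    -- uniform bound exists in general.
    have hm : ∀ {k : ℕ} (σ : SingSimplex X (k + 1)), ∃ m, σ ∈ P.carrier k → ∀ j ≥ m,
        (sd X (k + 1) ^ j) (Finsupp.single σ 1) ∈ Finsupp.supported ℤ ℤ (Q.carrier k) := by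
      intro k σ
      by_cases hσ : σ ∈ P.carrier k
      · obtain ⟨m, hm⟩ := exists_iterate_sd_mem_supported hU hV σ hσ
        refine ⟨m, fun _ j hj => ?_⟩
        rw [Module.End.coe_pow]
        exact hm j hj
      · exact ⟨0, fun h => absurd h hσ⟩
    choose m hm using @hm
    have hpowQ : ∀ {k : ℕ} (j : ℕ) {c : SingChain X (k + 1)},
        c ∈ Finsupp.supported ℤ ℤ (Q.carrier k) →
        (sd X (k + 1) ^ j) c ∈ Finsupp.supported ℤ ℤ (Q.carrier k) := by
      intro k j c hc
      induction j with
      | zero => simpa using hc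
      | succ j ih =>
        rw [pow_succ', Module.End.mul_apply]
        exact Q.sd_mem_supported affComp_mem_ofEither ih
    have hpowP : ∀ {k : ℕ} (j : ℕ) {c : SingChain X (k + 1)},
        c ∈ Finsupp.supported ℤ ℤ (P.carrier k) →
        (sd X (k + 1) ^ j) c ∈ Finsupp.supported ℤ ℤ (P.carrier k) := by
      intro k j c hc
      induction j with
      | zero => simpa using hc
      | succ j ih =>
        rw [pow_succ', Module.End.mul_apply]
        exact P.sd_mem_supported affComp_mem_of ih
    -- Raising the depth past `m τ` adds only homotopy terms supported on small simplices, where `x`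
    -- vanishes.
    have hstab : ∀ τ ∈ P.carrier n, ∀ j ≥ m τ,
        evalChain x.1 (iterSdHomotopy X j (n + 1) (Finsupp.single τ 1)) =
          evalChain x.1 (iterSdHomotopy X (m τ) (n + 1) (Finsupp.single τ 1)) := by
      intro τ hτ j hj
      induction j, hj using Nat.le_induction with
      | base => rfl
      | succ j hj ih =>
        rw [← ih, iterSdHomotopy, Finset.sum_range_succ, LinearMap.add_apply, map_add,
          LinearMap.comp_apply, evalChain_eq_zero x.2.2
            (Q.sdHomotopy_mem_supported affComp_mem_ofEither (hm τ hτ j hj)), add_zero]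
        rfl
    -- Write `T` for the iterated homotopy, so that `σ - sd^m σ = ∂Tσ + T∂σ`. The cocycle `x` kills
    -- `∂Tσ` and the small chain `sd^m σ`, hence `x(σ) = x(T∂σ)`. The primitive is thus `x ∘ T`,
    -- with depth depending on the simplex.
    let g : SingSimplex X (n + 1) → ℤ := fun τ => if τ ∈ P.carrier n then
      evalChain x.1 (iterSdHomotopy X (m τ) (n + 1) (Finsupp.single τ 1)) else 0
    have hg : g ∈ relCochain P Q n := by
      refine ⟨fun τ hτ => if_neg hτ, fun τ hτ => ?_⟩
      by_cases hτP : τ ∈ P.carrier n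
      · simp only [g, if_pos hτP]
        refine evalChain_eq_zero x.2.2 ?_
        rw [iterSdHomotopy, LinearMap.sum_apply]
        refine Submodule.sum_mem _ fun j _ => ?_
        exact Q.sdHomotopy_mem_supported affComp_mem_ofEither
          (hpowQ j (Finsupp.single_mem_supported ℤ _ hτ))
      · exact if_neg hτP
    refine ⟨(⟨g, hg⟩ : relCochain P Q n), ?_⟩
    rw [relComplex_d]
    refine relCochain_ext fun σ hσ => ?_
    refine (relCoboundary_apply ⟨g, hg⟩ hσ).trans ?_
    -- A depth common to `σ` and all its faces; by `hstab` it may replace their individual depths.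
    obtain ⟨M, hM0, hM⟩ : ∃ M, m σ ≤ M ∧ ∀ i, m (face i σ) ≤ M :=
      ⟨m σ + ∑ i, m (face i σ), Nat.le_add_right _ _, fun i =>
        (Finset.single_le_sum (f := fun i => m (face i σ)) (fun _ _ => Nat.zero_le _)
          (Finset.mem_univ i)).trans (Nat.le_add_left _ _)⟩
    have h1 : coboundary g σ =
        evalChain x.1 (iterSdHomotopy X M (n + 1) (boundary X (n + 1) (Finsupp.single σ 1))) := by
      rw [boundary_single, map_sum, map_sum]
      refine Finset.sum_congr rfl fun i _ => ?_
      have hi := P.face_mem i hσ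
      rw [map_smul, map_smul, hstab _ hi M (hM i), smul_eq_mul]
      simp only [g, if_pos hi]
    have h2 := congrArg (evalChain x.1) (boundary_iterSdHomotopy (n + 1) M (Finsupp.single σ 1))
    rw [evalChain_boundary, map_sub, map_sub, evalChain_single,
      evalChain_eq_zero x.2.2 (hm σ hσ M hM0), evalChain_eq_zero hx' ?_] at h2
    · rw [h1]
      linarith
    · rw [iterSdHomotopy, LinearMap.sum_apply]
      refine Submodule.sum_mem _ fun j _ => ?_
      exact P.sdHomotopy_mem_supported affComp_mem_of
        (hpowP j (Finsupp.single_mem_supported ℤ _ hσ))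

end excision

/-! ### Homotopic maps of pairs -/

section homotopy

variable {P Q : SimplexFamily X} {P' Q' : SimplexFamily Y}

theorem prism_mem_supported (h : C(X × stdSimplex ℝ (Fin 2), Y)) {n : ℕ}
    {s : Set (SingSimplex Y (n + 2))} {σ : SingSimplex X (n + 1)}
    (hs : ∀ w, prismComp h σ (n + 2) w ∈ s) :
    prism h (n + 1) (Finsupp.single σ 1) ∈ Finsupp.supported ℤ ℤ s := by
  rw [prism_single]
  exact realize_mem_supported (t := Set.univ) (fun w _ => hs w)
    (by rw [Finsupp.supported_univ]; trivial)

open Classical in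
/-- The prism operator on relative cochains. -/
def relPrism (h : C(X × stdSimplex ℝ (Fin 2), Y))
    (hQ : ∀ n, ∀ σ ∈ Q.carrier n, ∀ m w, prismComp h σ (m + 1) w ∈ Q'.carrier m) (n : ℕ) :
    relCochain P' Q' (n + 1) →ₗ[ℤ] relCochain P Q n where
  toFun f := ⟨fun σ => if σ ∈ P.carrier n then
      evalChain f.1 (prism h (n + 1) (Finsupp.single σ 1)) else 0,
    fun σ h => by simp [h],
    fun σ hσ => by
      simp [evalChain_eq_zero f.2.2 (prism_mem_supported h (hQ n σ hσ (n + 1)))]⟩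
  map_add' f g := by
    ext σ
    by_cases h : σ ∈ P.carrier n <;>
      simp [h, evalChain, Finsupp.linearCombination_apply, Finsupp.sum, mul_add,
        Finset.sum_add_distrib]
  map_smul' c f := by
    ext σ
    by_cases h : σ ∈ P.carrier n
    · simp only [h, evalChain, Finsupp.linearCombination_apply, Finsupp.sum, if_true,
        RingHom.id_apply, SetLike.val_smul, Pi.smul_apply, smul_eq_mul, Finset.mul_sum]
      exact Finset.sum_congr rfl fun i _ => mul_left_comm _ _ _
    · simp [h]

theorem relPrism_apply (h : C(X × stdSimplex ℝ (Fin 2), Y))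
    (hQ : ∀ n, ∀ σ ∈ Q.carrier n, ∀ m w, prismComp h σ (m + 1) w ∈ Q'.carrier m) (n : ℕ)
    (f : relCochain P' Q' (n + 1)) {σ : SingSimplex X (n + 1)} (hσ : σ ∈ P.carrier n) :
    (relPrism (P := P) h hQ n f).1 σ = evalChain f.1 (prism h (n + 1) (Finsupp.single σ 1)) :=
  if_pos hσ

/-- Homotopic maps of pairs induce homotopic maps of relative cochain complexes. -/
def relMapHomotopy (h : C(X × stdSimplex ℝ (Fin 2), Y))
    (hP : ∀ n, ∀ σ ∈ P.carrier n, ∀ m w, prismComp h σ (m + 1) w ∈ P'.carrier m)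
    (hQ : ∀ n, ∀ σ ∈ Q.carrier n, ∀ m w, prismComp h σ (m + 1) w ∈ Q'.carrier m)
    (φ ψ : C(X, Y)) (hφ : h.sliceRight (vertex 1) = φ) (hψ : h.sliceRight (vertex 0) = ψ)
    (hPφ : ∀ n, ∀ σ ∈ P.carrier n, φ.comp σ ∈ P'.carrier n)
    (hQφ : ∀ n, ∀ σ ∈ Q.carrier n, φ.comp σ ∈ Q'.carrier n)
    (hPψ : ∀ n, ∀ σ ∈ P.carrier n, ψ.comp σ ∈ P'.carrier n)
    (hQψ : ∀ n, ∀ σ ∈ Q.carrier n, ψ.comp σ ∈ Q'.carrier n) :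
    Homotopy (relMap φ hPφ hQφ) (relMap ψ hPψ hQψ) := by
  -- `boundary_prism` evaluated on a cochain. The cut-off coboundary may be used because the prism
  -- over a simplex of `P` is supported in `P'`.
  have key : ∀ {n : ℕ} (f : relCochain P' Q' n) {σ : SingSimplex X (n + 1)} (_ : σ ∈ P.carrier n),
      f.1 (φ.comp σ) = evalChain (relCoboundary P' Q' n f).1 (prism h (n + 1) (Finsupp.single σ 1)) +
        evalChain f.1 (prism h n (boundary X n (Finsupp.single σ 1))) + f.1 (ψ.comp σ) := by
    intro n f σ hσ
    have h1 := congrArg (evalChain f.1) (boundary_prism h n σ)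
    rw [evalChain_boundary, map_sub, map_sub, evalChain_single, evalChain_single, hφ, hψ,
      ← evalChain_congr (fun τ hτ => relCoboundary_apply f hτ)
        (prism_mem_supported h (hP n σ hσ (n + 1)))] at h1
    rw [h1]
    ring
  refine CochainComplex.mkHomotopy _ _ (fun n => ModuleCat.ofHom (relPrism h hQ n)) ?_ ?_
  · rw [relComplex_d]
    refine ModuleCat.hom_ext (LinearMap.ext fun (f : relCochain P' Q' 0) => ?_)
    refine relCochain_ext fun σ hσ => ?_
    refine (relMap_apply φ hPφ hQφ 0 f hσ).trans ((key f hσ).trans ?_)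
    rw [prism_zero, LinearMap.zero_apply, map_zero, add_zero]
    exact congrArg₂ (· + ·) (relPrism_apply h hQ 0 (relCoboundary P' Q' 0 f) hσ).symm
      (relMap_apply ψ hPψ hQψ 0 f hσ).symm
  · intro n
    rw [relComplex_d, relComplex_d]
    refine ModuleCat.hom_ext (LinearMap.ext fun (f : relCochain P' Q' (n + 1)) => ?_)
    refine relCochain_ext fun σ hσ => ?_
    refine (relMap_apply φ hPφ hQφ (n + 1) f hσ).trans ((key f hσ).trans ?_)
    refine congrArg₂ (· + ·) (congrArg₂ (· + ·)
      (relPrism_apply h hQ (n + 1) (relCoboundary P' Q' (n + 1) f) hσ).symm ?_)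
      (relMap_apply ψ hPψ hQψ (n + 1) f hσ).symm
    refine Eq.trans ?_ (relCoboundary_apply (relPrism h hQ n f) hσ).symm
    rw [boundary_single, map_sum, map_sum]
    refine Finset.sum_congr rfl fun i _ => ?_
    rw [map_smul, map_smul, smul_eq_mul, relPrism_apply h hQ n f (P.face_mem i hσ)]

end homotopy

end

open stdSimplex

/-! ### Comparison with the singular cohomology of the statement -/

section bridge

open Simplicial

variable (X : Type u) [TopologicalSpace X]

/-- The simplex of the singular simplicial set given by a continuous map. -/
def toSSetSimplex {n : ℕ} (σ : SingSimplex X (n + 1)) : (TopCat.toSSet.obj (TopCat.of X)) _⦋n⦌ :=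
  (TopCat.toSSetObjEquiv (TopCat.of X) (.op ⦋n⦌)).symm σ

theorem toSSetSimplex_surjective {n : ℕ} :
    Function.Surjective (toSSetSimplex X (n := n)) :=
  (TopCat.toSSetObjEquiv (TopCat.of X) (.op ⦋n⦌)).symm.surjective

theorem δ_toSSetSimplex {n : ℕ} (i : Fin (n + 2)) (σ : SingSimplex X (n + 2)) :
    (TopCat.toSSet.obj (TopCat.of X)).δ i (toSSetSimplex X σ) =
      toSSetSimplex X (SingSimplex.face i σ) := by
  refine (TopCat.toSSetObjEquiv (TopCat.of X) (.op ⦋n⦌)).injective ?_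
  rw [toSSetSimplex, toSSetSimplex, Equiv.apply_symm_apply]
  refine ContinuousMap.ext fun t => ?_
  have := affMap_vertex_comp i.succAbove t
  refine Eq.trans ?_ (congrArg σ this.symm)
  rfl

/-- The chain complex whose dual is the singular cochain complex. -/
abbrev singularChains : ChainComplex (ModuleCat.{u} ℤ) ℕ :=
  (TopCat.toSSet.obj (TopCat.of X)).chainComplex (ModuleCat.of ℤ (ULift.{u} ℤ))

/-- The inclusion of the summand given by a singular simplex. -/
def singularChains.ι {n : ℕ} (σ : SingSimplex X (n + 1)) :
    ModuleCat.of ℤ (ULift.{u} ℤ) ⟶ (singularChains X).X n :=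
  SSet.ιChainComplex (TopCat.toSSet.obj (TopCat.of X)) (toSSetSimplex X σ)

theorem singularChains.ι_d {n : ℕ} (σ : SingSimplex X (n + 2)) :
    singularChains.ι X σ ≫ (singularChains X).d (n + 1) n =
      ∑ i : Fin (n + 2), (-1) ^ i.val • singularChains.ι X (SingSimplex.face i σ) := by
  rw [singularChains.ι, SSet.ιChainComplex_d]
  simp only [δ_toSSetSimplex]
  rfl

theorem SimplexFamily.mem_of_univ {n : ℕ} (σ : SingSimplex X (n + 1)) :
    σ ∈ (SimplexFamily.of (Set.univ : Set X)).carrier n := Set.subset_univ _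

theorem SimplexFamily.notMem_of_empty {n : ℕ} (σ : SingSimplex X (n + 1)) :
    σ ∉ (SimplexFamily.of (∅ : Set X)).carrier n := fun h => h ⟨vertex 0, rfl⟩

/-- The singular cochain complex, as functions on singular simplices. -/
abbrev absComplex : CochainComplex (ModuleCat.{u} ℤ) ℕ :=
  relComplex (SimplexFamily.of (Set.univ : Set X)) (SimplexFamily.of ∅)

/-- The function on singular simplices given by a homomorphism on singular chains. -/
def toFunctions (n : ℕ) :
    ((singularChains X).X n ⟶ ModuleCat.of ℤ (ULift.{u} ℤ)) →ₗ[ℤ]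
      relCochain (SimplexFamily.of (Set.univ : Set X)) (SimplexFamily.of ∅) n where
  toFun g := ⟨fun σ => ((singularChains.ι X σ ≫ g).hom (ULift.up 1)).down,
    fun σ h => absurd (SimplexFamily.mem_of_univ X σ) h,
    fun σ h => absurd h (SimplexFamily.notMem_of_empty X σ)⟩
  map_add' _ _ := rfl
  map_smul' _ _ := rfl

/-- The module of chains is a coproduct of copies of `ℤ` indexed by simplices, so its dual is the
set of all functions on simplices. -/
theorem toFunctions_bijective (n : ℕ) : Function.Bijective (toFunctions X n) := by
  constructor
  · intro f g h
    refine SSet.chainComplex_hom_ext fun x => ?_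
    obtain ⟨σ, rfl⟩ := toSSetSimplex_surjective X x
    refine ModuleCat.hom_ext (LinearMap.ext fun a => ?_)
    have h1 : (singularChains.ι X σ ≫ f).hom (ULift.up 1) =
        (singularChains.ι X σ ≫ g).hom (ULift.up 1) :=
      ULift.down_injective (congrFun (congrArg Subtype.val h) σ)
    have ha : a = a.down • (ULift.up 1 : ULift.{u} ℤ) := ULift.down_injective (by simp)
    rw [ha, map_smul, map_smul]
    exact congrArg (a.down • ·) h1
  · intro f
    let e : ∀ x : (TopCat.toSSet.obj (TopCat.of X)) _⦋n⦌,
        ModuleCat.of ℤ (ULift.{u} ℤ) ⟶ ModuleCat.of ℤ (ULift.{u} ℤ) := fun x =>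
      f.1 (TopCat.toSSetObjEquiv (TopCat.of X) (.op ⦋n⦌) x) • 𝟙 _
    refine ⟨Limits.Cofan.IsColimit.desc (SSet.isColimitChainComplexXCofan _ _ n) e, ?_⟩
    refine relCochain_ext fun σ _ => ?_
    have h1 : singularChains.ι X σ ≫
        Limits.Cofan.IsColimit.desc (SSet.isColimitChainComplexXCofan _ _ n) e =
          f.1 σ • 𝟙 _ := by
      refine (Limits.Cofan.IsColimit.fac (SSet.isColimitChainComplexXCofan _ _ n) e
        (toSSetSimplex X σ)).trans ?_
      simp only [e, toSSetSimplex, Equiv.apply_symm_apply]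
    refine (congrArg (fun φ : ModuleCat.of ℤ (ULift.{u} ℤ) ⟶ ModuleCat.of ℤ (ULift.{u} ℤ) =>
      (φ.hom (ULift.up 1)).down) h1).trans ?_
    simp

/-- The comparison of the singular cochain complex with functions on singular simplices. -/
def singularCochainComplexToAbs : (singularCochainComplex X) ⟶ absComplex X where
  f n := ModuleCat.ofHom (X := (singularCochainComplex X).X n) (toFunctions X n)
  comm' := by
    rintro n _ rfl
    rw [relComplex_d]
    refine ModuleCat.hom_ext (LinearMap.ext fun
      (g : (singularChains X).X n ⟶ ModuleCat.of ℤ (ULift.{u} ℤ)) => ?_)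
    refine relCochain_ext fun σ hσ => ?_
    refine (relCoboundary_apply (toFunctions X n g) hσ).trans ?_
    have h1 : singularChains.ι X σ ≫ (singularChains X).d (n + 1) n ≫ g =
        ∑ i : Fin (n + 2), (-1) ^ i.val • (singularChains.ι X (SingSimplex.face i σ) ≫ g) := by
      rw [← Category.assoc, singularChains.ι_d, Preadditive.sum_comp]
      simp only [Preadditive.zsmul_comp]
    refine Eq.trans ?_ (congrArg (fun φ : ModuleCat.of ℤ (ULift.{u} ℤ) ⟶
      ModuleCat.of ℤ (ULift.{u} ℤ) => (φ.hom (ULift.up 1)).down) h1).symm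
    have h2 : ∀ (s : Finset (Fin (n + 2)))
        (F : Fin (n + 2) → (ModuleCat.of ℤ (ULift.{u} ℤ) ⟶ ModuleCat.of ℤ (ULift.{u} ℤ))),
        ((∑ i ∈ s, F i).hom (ULift.up 1)).down = ∑ i ∈ s, ((F i).hom (ULift.up 1)).down := by
      classical
      intro s F
      induction s using Finset.induction_on with
      | empty => simp
      | insert a s ha ih => rw [Finset.sum_insert ha, Finset.sum_insert ha, ← ih]; rfl
    rw [h2]
    rfl

instance : IsIso (singularCochainComplexToAbs X) := by
  have : ∀ n, IsIso ((singularCochainComplexToAbs X).f n) := fun n => by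
    rw [ConcreteCategory.isIso_iff_bijective]
    exact toFunctions_bijective X n
  exact HomologicalComplex.Hom.isIso_of_components _

end bridge

/-- The relative singular cohomology of a pair of families of simplices. -/
abbrev relCohomology {X : Type u} [TopologicalSpace X] (P Q : SimplexFamily X) (n : ℕ) :
    ModuleCat.{u} ℤ :=
  (relComplex P Q).homology n

theorem nonempty_singularCohomology_equiv (X : Type u) [TopologicalSpace X] (n : ℕ) :
    Nonempty (singularCohomology X n ≃ₗ[ℤ]
      relCohomology (SimplexFamily.of (Set.univ : Set X)) (SimplexFamily.of ∅) n) :=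
  ⟨(HomologicalComplex.homologyMapIso (asIso (singularCochainComplexToAbs X)) n).toLinearEquiv⟩

/-! ### Exact sequences and excision -/

section sequences

variable {X Y : Type u} [TopologicalSpace X] [TopologicalSpace Y]
  {P Q R : SimplexFamily X} {P' Q' : SimplexFamily Y}

theorem nonempty_relCohomology_equiv_of_isIso {φ : relComplex P Q ⟶ relComplex P' Q'} (h : IsIso φ)
    (n : ℕ) : Nonempty (relCohomology P Q n ≃ₗ[ℤ] relCohomology P' Q' n) :=
  ⟨(HomologicalComplex.homologyMapIso (asIso φ) n).toLinearEquiv⟩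

/-- The long exact sequence of a triple. -/
theorem exists_long_exact_sequence (hRQ : ∀ n, R.carrier n ⊆ Q.carrier n)
    (hQP : ∀ n, Q.carrier n ⊆ P.carrier n) :
    ∃ (a : ∀ n, relCohomology P Q n →ₗ[ℤ] relCohomology P R n)
      (b : ∀ n, relCohomology P R n →ₗ[ℤ] relCohomology Q R n)
      (δ : ∀ n, relCohomology Q R n →ₗ[ℤ] relCohomology P Q (n + 1)),
      (∀ n, Function.Exact (a n) (b n)) ∧ (∀ n, Function.Exact (b n) (δ n)) ∧
        (∀ n, Function.Exact (δ n) (a (n + 1))) ∧ Function.Injective (a 0) := by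
  obtain ⟨f, g, w, hS⟩ := exists_shortExact_relComplex hRQ hQP
  refine ⟨fun n => (HomologicalComplex.homologyMap f n).hom,
    fun n => (HomologicalComplex.homologyMap g n).hom,
    fun n => (hS.δ n (n + 1) rfl).hom, fun n => ?_, fun n => ?_, fun n => ?_, ?_⟩
  · exact (ShortComplex.ShortExact.moduleCat_exact_iff_function_exact _).1 (hS.homology_exact₂ n)
  · exact (ShortComplex.ShortExact.moduleCat_exact_iff_function_exact _).1
      (hS.homology_exact₃ n (n + 1) rfl)
  · exact (ShortComplex.ShortExact.moduleCat_exact_iff_function_exact _).1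
      (hS.homology_exact₁ n (n + 1) rfl)
  · have := hS.mono_f
    have := HomologicalComplex.mono_homologyMap_of_mono_of_not_rel f 0 (by simp)
    exact (ModuleCat.mono_iff_injective _).1 this

/-- If `H(P, R) = 0`, then `H(Q, R)` is `H(P, Q)` shifted by one. -/
theorem relCohomology_shift (hRQ : ∀ n, R.carrier n ⊆ Q.carrier n)
    (hQP : ∀ n, Q.carrier n ⊆ P.carrier n) (h : ∀ n, Subsingleton (relCohomology P R n)) :
    (∀ n, Nonempty (relCohomology P Q (n + 1) ≃ₗ[ℤ] relCohomology Q R n)) ∧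
      Subsingleton (relCohomology P Q 0) := by
  obtain ⟨a, b, δ, h1, h2, h3, h4⟩ := exists_long_exact_sequence hRQ hQP
  refine ⟨fun n => ⟨(LinearEquiv.ofBijective (δ n) ⟨?_, ?_⟩).symm⟩, h4.subsingleton⟩
  · rw [injective_iff_map_eq_zero]
    intro x hx
    obtain ⟨y, rfl⟩ := (h2 n x).1 hx
    rw [Subsingleton.elim y 0, map_zero]
  · exact fun x => (h3 n x).1 (Subsingleton.elim _ _)

/-- If `H(P, Q) = 0`, then `H(P, R) = H(Q, R)`. -/
theorem nonempty_relCohomology_equiv_of_subsingleton (hRQ : ∀ n, R.carrier n ⊆ Q.carrier n)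
    (hQP : ∀ n, Q.carrier n ⊆ P.carrier n) (h : ∀ n, Subsingleton (relCohomology P Q n)) (n : ℕ) :
    Nonempty (relCohomology P R n ≃ₗ[ℤ] relCohomology Q R n) := by
  obtain ⟨a, b, δ, h1, h2, h3, h4⟩ := exists_long_exact_sequence hRQ hQP
  refine ⟨LinearEquiv.ofBijective (b n) ⟨?_, ?_⟩⟩
  · rw [injective_iff_map_eq_zero]
    intro x hx
    obtain ⟨y, rfl⟩ := (h1 n x).1 hx
    rw [Subsingleton.elim y 0, map_zero]
  · exact fun x => (h2 n x).1 (Subsingleton.elim _ _)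

/-- Excision. -/
theorem nonempty_excision {U V : Set X} (hU : IsOpen U) (hV : IsOpen V) (n : ℕ) :
    Nonempty (relCohomology (SimplexFamily.of (U ∪ V)) (SimplexFamily.of V) n ≃ₗ[ℤ]
      relCohomology (SimplexFamily.of U) (SimplexFamily.of (U ∩ V)) n) := by
  -- Acyclicity lets the simplices of `U ∪ V` be replaced by the small ones.
  obtain ⟨e⟩ := nonempty_relCohomology_equiv_of_subsingleton (P := SimplexFamily.of (U ∪ V))
    (Q := SimplexFamily.ofEither U V) (R := SimplexFamily.of V) (fun n σ h => Or.inr h)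
    (fun n σ h => h.elim (fun h => h.trans Set.subset_union_left)
      (fun h => h.trans Set.subset_union_right))
    (fun n => ModuleCat.subsingleton_of_isZero (isZero_homology_of_union hU hV n)) n
  -- A small simplex not in `V` lies in `U`, so the two pairs have the same relative cochains.
  obtain ⟨e'⟩ := nonempty_relCohomology_equiv_of_isIso (isIso_relMap
    (P := SimplexFamily.of U) (Q := SimplexFamily.of (U ∩ V))
    (P' := SimplexFamily.ofEither U V) (Q' := SimplexFamily.of V) (ContinuousMap.id X)
    (fun n σ h => Or.inl h) (fun n σ h => h.trans Set.inter_subset_right)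
    Function.injective_id (fun n σ h h' => Set.subset_inter h h')
    (fun n τ h h' => ⟨τ, h.resolve_right h', rfl⟩)) n
  exact ⟨e.trans e'⟩

end sequences

open stdSimplex SingSimplex

/-! ### Deformations and retracts of pairs -/

section homotopy

variable {X Y : Type u} [TopologicalSpace X] [TopologicalSpace Y]

theorem prismComp_mem_of {S : Set X} {S' : Set Y} {h : C(X × stdSimplex ℝ (Fin 2), Y)}
    (hS : ∀ x ∈ S, ∀ t, h (x, t) ∈ S') (n : ℕ) (σ : SingSimplex X (n + 1))
    (hσ : σ ∈ (SimplexFamily.of S).carrier n) (m : ℕ)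
    (w : Fin (m + 1) → stdSimplex ℝ (Fin (n + 1)) × stdSimplex ℝ (Fin 2)) :
    prismComp h σ (m + 1) w ∈ (SimplexFamily.of S').carrier m := by
  rintro _ ⟨t, rfl⟩
  exact hS _ (hσ ⟨_, rfl⟩) _

theorem comp_mem_of {S : Set X} {S' : Set Y} {φ : C(X, Y)} (h : ∀ x ∈ S, φ x ∈ S') (n : ℕ)
    (σ : SingSimplex X (n + 1)) (hσ : σ ∈ (SimplexFamily.of S).carrier n) :
    φ.comp σ ∈ (SimplexFamily.of S').carrier n := by
  rintro _ ⟨t, rfl⟩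
  exact h _ (hσ ⟨_, rfl⟩)

theorem of_mono {S T : Set X} (h : S ⊆ T) (n : ℕ) :
    (SimplexFamily.of S).carrier n ⊆ (SimplexFamily.of T).carrier n :=
  fun _ hσ => Set.Subset.trans hσ h

/-- If a pair deforms, through maps of pairs, into its second member, then its relative
cohomology vanishes. -/
theorem subsingleton_relCohomology_of_deformation {S T : Set X}
    (h : C(X × stdSimplex ℝ (Fin 2), X)) (hS : ∀ x ∈ S, ∀ t, h (x, t) ∈ S)
    (hT : ∀ x ∈ T, ∀ t, h (x, t) ∈ T) (h1 : ∀ x, h (x, vertex 1) = x)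
    (h0 : ∀ x ∈ S, h (x, vertex 0) ∈ T) (n : ℕ) :
    Subsingleton (relCohomology (SimplexFamily.of S) (SimplexFamily.of T) n) := by
  have H := relMapHomotopy h (prismComp_mem_of hS) (prismComp_mem_of hT) (h.sliceRight (vertex 1))
    (h.sliceRight (vertex 0)) rfl rfl (comp_mem_of fun x hx => hS x hx _)
    (comp_mem_of fun x hx => hT x hx _) (comp_mem_of fun x hx => hS x hx _)
    (comp_mem_of fun x hx => hT x hx _)
  have := H.homologyMap_eq n
  rw [relMap_eq_id _ h1, relMap_eq_zero _ _ _ (comp_mem_of h0), HomologicalComplex.homologyMap_id,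
    HomologicalComplex.homologyMap_zero] at this
  exact ModuleCat.subsingleton_of_isZero ((Limits.IsZero.iff_id_eq_zero _).2 this)

/-- Deformation retracts of pairs have the same relative cohomology. -/
theorem nonempty_relCohomology_equiv_of_retract {S T : Set X} {S' T' : Set Y} (i : C(Y, X))
    (p : C(X, Y)) (h : C(X × stdSimplex ℝ (Fin 2), X)) (hS : ∀ x ∈ S, ∀ t, h (x, t) ∈ S)
    (hT : ∀ x ∈ T, ∀ t, h (x, t) ∈ T) (h1 : ∀ x, h (x, vertex 1) = x)
    (h0 : ∀ x, h (x, vertex 0) = i (p x)) (hpi : ∀ y, p (i y) = y)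
    (hiS : ∀ y ∈ S', i y ∈ S) (hiT : ∀ y ∈ T', i y ∈ T) (hpS : ∀ x ∈ S, p x ∈ S')
    (hpT : ∀ x ∈ T, p x ∈ T') (n : ℕ) :
    Nonempty (relCohomology (SimplexFamily.of S) (SimplexFamily.of T) n ≃ₗ[ℤ]
      relCohomology (SimplexFamily.of S') (SimplexFamily.of T') n) := by
  have H := relMapHomotopy h (prismComp_mem_of hS) (prismComp_mem_of hT) (h.sliceRight (vertex 1))
    (i.comp p) rfl (ContinuousMap.ext h0) (comp_mem_of fun x hx => hS x hx _)
    (comp_mem_of fun x hx => hT x hx _) (comp_mem_of fun x hx => hiS _ (hpS x hx))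
    (comp_mem_of fun x hx => hiT _ (hpT x hx))
  rw [relMap_eq_id _ h1] at H
  let e : HomotopyEquiv (relComplex (SimplexFamily.of S) (SimplexFamily.of T))
      (relComplex (SimplexFamily.of S') (SimplexFamily.of T')) :=
    { hom := relMap i (comp_mem_of hiS) (comp_mem_of hiT)
      inv := relMap p (comp_mem_of hpS) (comp_mem_of hpT)
      homotopyHomInvId := (Homotopy.ofEq (relMap_comp _ _ _ _ _ _)).trans H.symm
      homotopyInvHomId := Homotopy.ofEq
        ((relMap_comp _ _ _ _ _ _).trans (relMap_eq_id _ hpi _ _)) }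
  exact ⟨(e.toHomologyIso n).toLinearEquiv⟩

end homotopy

/-! ### Suspension and the Thom isomorphism -/

section suspension

/-- The homotopy that moves the real coordinate linearly to `c`. -/
def lineHomotopy (Y : Type u) [TopologicalSpace Y] (c : ℝ) :
    C((Y × ℝ) × stdSimplex ℝ (Fin 2), Y × ℝ) where
  toFun p := (p.1.1, p.2 1 * p.1.2 + p.2 0 * c)
  continuous_toFun := by
    have h : ∀ i : Fin 2, Continuous fun p : (Y × ℝ) × stdSimplex ℝ (Fin 2) => p.2 i := fun i =>
      (continuous_apply i).comp (continuous_subtype_val.comp continuous_snd)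
    exact (continuous_fst.comp continuous_fst).prodMk
      (((h 1).mul (continuous_snd.comp continuous_fst)).add ((h 0).mul continuous_const))

variable {Y : Type u} [TopologicalSpace Y]

theorem lineHomotopy_apply (c : ℝ) (y : Y) (r : ℝ) (t : stdSimplex ℝ (Fin 2)) :
    lineHomotopy Y c ((y, r), t) = (y, t 1 * r + t 0 * c) := rfl

theorem lineHomotopy_one (c : ℝ) (x : Y × ℝ) : lineHomotopy Y c (x, vertex 1) = x := by
  obtain ⟨y, r⟩ := x
  simp [lineHomotopy_apply]

theorem lineHomotopy_zero (c : ℝ) (x : Y × ℝ) : lineHomotopy Y c (x, vertex 0) = (x.1, c) := by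
  obtain ⟨y, r⟩ := x
  simp [lineHomotopy_apply]

theorem convexComb_pos {t : stdSimplex ℝ (Fin 2)} {r c : ℝ} (hr : 0 < r) (hc : 0 < c) :
    0 < t 1 * r + t 0 * c := by
  have h := stdSimplex.add_eq_one t
  rcases (stdSimplex.zero_le t 0).lt_or_eq with h0 | h0
  · have := mul_pos h0 hc
    have := mul_nonneg (stdSimplex.zero_le t 1) hr.le
    linarith
  · rw [← h0, zero_add] at h
    rw [h, ← h0]
    linarith

theorem isOpen_suspension {B : Set Y} (hB : IsOpen B) :
    IsOpen {p : Y × ℝ | p.1 ∈ B ∨ p.2 ≠ 0} :=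
  (hB.preimage continuous_fst).union (isOpen_ne.preimage continuous_snd)

/-- The relative cohomology of the product of a pair with `(ℝ, ℝ \ {0})`. -/
theorem relCohomology_suspension {B : Set Y} (hB : IsOpen B) :
    (∀ n, Nonempty (relCohomology (SimplexFamily.of (Set.univ : Set (Y × ℝ)))
        (SimplexFamily.of {p : Y × ℝ | p.1 ∈ B ∨ p.2 ≠ 0}) (n + 1) ≃ₗ[ℤ]
      relCohomology (SimplexFamily.of (Set.univ : Set Y)) (SimplexFamily.of B) n)) ∧
    Subsingleton (relCohomology (SimplexFamily.of (Set.univ : Set (Y × ℝ)))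
        (SimplexFamily.of {p : Y × ℝ | p.1 ∈ B ∨ p.2 ≠ 0}) 0) := by
  -- The subspace is covered by the parts above and below the zero level, which meet exactly in `B ×
  -- ℝ`.
  set Ap : Set (Y × ℝ) := {p | p.1 ∈ B ∨ 0 < p.2}
  set Am : Set (Y × ℝ) := {p | p.1 ∈ B ∨ p.2 < 0}
  have hAp : IsOpen Ap :=
    (hB.preimage continuous_fst).union ((isOpen_lt continuous_const continuous_snd))
  have hAm : IsOpen Am :=
    (hB.preimage continuous_fst).union ((isOpen_lt continuous_snd continuous_const))
  have hA : {p : Y × ℝ | p.1 ∈ B ∨ p.2 ≠ 0} = Am ∪ Ap := by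
    ext p
    simp only [Set.mem_ofPred_eq, Set.mem_union, ne_iff_lt_or_gt, Ap, Am]
    tauto
  rw [hA]
  -- Sliding the real coordinate to 1 pushes everything into `Ap`, so the pair with `Ap` is acyclic.
  -- This yields the degree shift of `relCohomology_shift`.
  have hp0 : ∀ n, Subsingleton (relCohomology (SimplexFamily.of (Set.univ : Set (Y × ℝ)))
      (SimplexFamily.of Ap) n) := by
    refine subsingleton_relCohomology_of_deformation (lineHomotopy Y 1) (fun _ _ _ => trivial)
      ?_ (lineHomotopy_one 1) ?_
    · rintro ⟨y, r⟩ h t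
      exact h.imp id fun hr => convexComb_pos hr one_pos
    · intro x _
      rw [lineHomotopy_zero]
      exact Or.inr one_pos
  obtain ⟨h1, h2⟩ := relCohomology_shift (P := SimplexFamily.of (Set.univ : Set (Y × ℝ)))
    (Q := SimplexFamily.of (Am ∪ Ap)) (R := SimplexFamily.of Ap)
    (of_mono Set.subset_union_right) (of_mono (Set.subset_univ _)) hp0
  refine ⟨fun n => ?_, h2⟩
  obtain ⟨e1⟩ := h1 n
  obtain ⟨e2⟩ := nonempty_excision hAm hAp n
  have hint : ∀ p : Y × ℝ, p ∈ Am ∩ Ap → p.1 ∈ B := by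
    rintro ⟨y, r⟩ ⟨h | h, h' | h'⟩
    · exact h
    · exact h
    · exact h'
    · exact absurd h (lt_asymm h')
  -- After excision of the upper half, the pair retracts onto the slice at height -1, a copy of `(Y,
  -- B)`.
  obtain ⟨e3⟩ := nonempty_relCohomology_equiv_of_retract (S := Am) (T := Am ∩ Ap)
    (S' := (Set.univ : Set Y)) (T' := B)
    ((ContinuousMap.id Y).prodMk (ContinuousMap.const Y (-1 : ℝ))) ContinuousMap.fst
    (lineHomotopy Y (-1))
    (by
      rintro ⟨y, r⟩ h t
      refine h.imp id fun hr => ?_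
      have := convexComb_pos (t := t) (neg_pos.2 hr) one_pos
      change t 1 * r + t 0 * (-1) < 0
      linarith)
    (fun x hx t => ⟨Or.inl (hint x hx), Or.inl (hint x hx)⟩)
    (lineHomotopy_one _) (fun x => lineHomotopy_zero _ x) (fun y => rfl)
    (fun y _ => Or.inr (by change (-1 : ℝ) < 0; norm_num)) (fun y hy => ⟨Or.inl hy, Or.inl hy⟩)
    (fun _ _ => trivial) hint n
  exact ⟨e1.trans (e2.trans e3)⟩

/-- The points of `Y × ℝ⁴` whose second coordinate is not the origin. -/
def offZeroSection (Y : Type u) : Set ((((Y × ℝ) × ℝ) × ℝ) × ℝ) :=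
  {p | (((p.1.1.1.1 ∈ (∅ : Set Y) ∨ p.1.1.1.2 ≠ 0) ∨ p.1.1.2 ≠ 0) ∨ p.1.2 ≠ 0) ∨ p.2 ≠ 0}

/-- The Thom isomorphism for a trivial bundle of rank four. -/
theorem relCohomology_offZeroSection :
    (∀ n, Nonempty (relCohomology (SimplexFamily.of (Set.univ : Set ((((Y × ℝ) × ℝ) × ℝ) × ℝ)))
        (SimplexFamily.of (offZeroSection Y)) (n + 4) ≃ₗ[ℤ]
      relCohomology (SimplexFamily.of (Set.univ : Set Y)) (SimplexFamily.of ∅) n)) ∧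
    ∀ n < 4, Subsingleton (relCohomology
      (SimplexFamily.of (Set.univ : Set ((((Y × ℝ) × ℝ) × ℝ) × ℝ)))
        (SimplexFamily.of (offZeroSection Y)) n) := by
  have o1 := isOpen_suspension (isOpen_empty (X := Y))
  have o2 := isOpen_suspension o1
  have o3 := isOpen_suspension o2
  have s1 := relCohomology_suspension (isOpen_empty (X := Y))
  have s2 := relCohomology_suspension o1
  have s3 := relCohomology_suspension o2
  have s4 := relCohomology_suspension o3
  refine ⟨fun n => ?_, fun n hn => ?_⟩
  · obtain ⟨e1⟩ := s1.1 n
    obtain ⟨e2⟩ := s2.1 (n + 1)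
    obtain ⟨e3⟩ := s3.1 (n + 2)
    obtain ⟨e4⟩ := s4.1 (n + 3)
    exact ⟨e4.trans (e3.trans (e2.trans e1))⟩
  -- In degree `n < 4`, removing `n` suspensions leads to degree zero of a pair that is still a
  -- suspension, where the group vanishes.
  · have h0 := s4.2
    have h1 : Subsingleton _ := (s4.1 0).some.toEquiv.subsingleton_congr.2 s3.2
    have h2 : Subsingleton _ :=
      ((s4.1 1).some.trans (s3.1 0).some).toEquiv.subsingleton_congr.2 s2.2
    have h3 : Subsingleton _ :=
      ((s4.1 2).some.trans ((s3.1 1).some.trans (s2.1 0).some)).toEquiv.subsingleton_congr.2 s1.2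
    interval_cases n
    exacts [h0, h1, h2, h3]

end suspension

/-! ### Passage to subspaces -/

section subspaces

variable {X Y : Type u} [TopologicalSpace X] [TopologicalSpace Y]

/-- Relative cohomology pulled back along an embedding. -/
theorem nonempty_relCohomology_equiv_of_isEmbedding {j : C(Y, X)} (hj : Topology.IsEmbedding j)
    (M : Set X) (n : ℕ) :
    Nonempty (relCohomology (SimplexFamily.of (Set.range j)) (SimplexFamily.of (Set.range j ∩ M)) n
      ≃ₗ[ℤ] relCohomology (SimplexFamily.of (Set.univ : Set Y)) (SimplexFamily.of (j ⁻¹' M)) n) := by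
  refine nonempty_relCohomology_equiv_of_isIso (isIso_relMap (P := SimplexFamily.of Set.univ)
    (Q := SimplexFamily.of (j ⁻¹' M)) (P' := SimplexFamily.of (Set.range j))
    (Q' := SimplexFamily.of (Set.range j ∩ M)) j (comp_mem_of fun x _ => ⟨x, rfl⟩)
    (comp_mem_of fun x hx => ⟨⟨x, rfl⟩, hx⟩) hj.injective ?_ ?_) n
  · rintro n σ - h _ ⟨t, rfl⟩
    exact (h ⟨t, rfl⟩).2
  · intro n τ hτ _
    choose f hf using fun t => hτ ⟨t, rfl⟩
    refine ⟨⟨f, hj.isInducing.continuous_iff.2 ?_⟩, Set.subset_univ _, ContinuousMap.ext hf⟩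
    rw [show j ∘ f = τ from funext hf]
    exact τ.continuous

theorem nonempty_singularCohomology_subtype_equiv (S : Set X) (n : ℕ) :
    Nonempty (singularCohomology S n ≃ₗ[ℤ]
      relCohomology (SimplexFamily.of S) (SimplexFamily.of ∅) n) := by
  obtain ⟨e1⟩ := nonempty_singularCohomology_equiv S n
  have h := nonempty_relCohomology_equiv_of_isEmbedding
    (j := (⟨Subtype.val, continuous_subtype_val⟩ : C(S, X))) Topology.IsEmbedding.subtypeVal ∅ n
  have hr : Set.range (⟨Subtype.val, continuous_subtype_val⟩ : C(S, X)) = S := Subtype.range_coe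
  rw [Set.inter_empty, hr, Set.preimage_empty] at h
  obtain ⟨e2⟩ := h
  exact ⟨e1.trans e2.symm⟩

end subspaces

open stdSimplex SingSimplex

/-! ### Cohomology of contractible spaces -/

section point

variable {Y : Type u} [TopologicalSpace Y] [Unique Y]

/-- All `n + 2` faces coincide, so only the alternating sum of their signs matters. -/
theorem coboundary_of_unique {n : ℕ} (f : SingSimplex Y (n + 1) → ℤ) (σ : SingSimplex Y (n + 2)) :
    coboundary f σ = if Even n then 0 else f default := by
  have h : ∀ τ : SingSimplex Y (n + 1), f τ = f default := fun τ =>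
    congrArg f (ContinuousMap.ext fun t => Subsingleton.elim _ _)
  rw [coboundary, Finset.sum_congr rfl fun i _ => by rw [h], ← Finset.sum_mul,
    Fin.sum_univ_eq_sum_range (fun i => (-1 : ℤ) ^ i), neg_one_geom_sum]
  by_cases hn : Even n
  · rw [if_pos hn, if_pos (by simp [hn]), zero_mul]
  · rw [if_neg hn, if_neg (by simpa [Nat.even_add_one] using hn), one_mul]

/-- The evaluation of cochains on a one-point space. -/
def relCochainUniqueEquiv (n : ℕ) :
    relCochain (SimplexFamily.of (Set.univ : Set Y)) (SimplexFamily.of ∅) n ≃ₗ[ℤ] ℤ where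
  toFun f := f.1 default
  map_add' _ _ := rfl
  map_smul' _ _ := rfl
  invFun a := ⟨fun _ => a, fun σ h => absurd (SimplexFamily.mem_of_univ Y σ) h,
    fun σ h => absurd h (SimplexFamily.notMem_of_empty Y σ)⟩
  left_inv f := relCochain_ext fun _ _ =>
    congrArg f.1 (ContinuousMap.ext fun _ => Subsingleton.elim _ _)
  right_inv _ := rfl

/-- The complex is `ℤ → ℤ → ℤ → ⋯` with differentials alternately 0 and 1, beginning with 0. -/
theorem relCohomology_of_unique :
    Nonempty (relCohomology (SimplexFamily.of (Set.univ : Set Y)) (SimplexFamily.of ∅) 0 ≃ₗ[ℤ] ℤ) ∧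
    ∀ n, Subsingleton
      (relCohomology (SimplexFamily.of (Set.univ : Set Y)) (SimplexFamily.of ∅) (n + 1)) := by
  constructor
  · have hd : (absComplex Y).d 0 1 = 0 := by
      rw [relComplex_d]
      refine ModuleCat.hom_ext (LinearMap.ext fun f => relCochain_ext fun σ hσ => ?_)
      refine (relCoboundary_apply f hσ).trans ?_
      rw [coboundary_of_unique, if_pos Even.zero]
      rfl
    let e := (absComplex Y).isoHomologyπ₀.symm ≪≫ (absComplex Y).iCyclesIso 0 1 (by simp) hd
    exact ⟨e.toLinearEquiv.trans (relCochainUniqueEquiv 0)⟩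
  · intro n
    refine ModuleCat.subsingleton_of_isZero (CochainComplex.isZero_homology_succ n
      fun (x : relCochain (SimplexFamily.of (Set.univ : Set Y)) (SimplexFamily.of ∅) (n + 1)) hx => ?_)
    rw [relComplex_d] at hx ⊢
    -- For even `n` the differential leaving degree `n + 1` is an isomorphism and there are no
    -- nonzero cocycles; for odd `n` the differential entering it is.
    by_cases hn : Even n
    · have h1 := relCoboundary_apply x (SimplexFamily.mem_of_univ Y default)
      rw [coboundary_of_unique, if_neg (by simpa [Nat.even_add_one] using hn)] at h1
      have h2 : x.1 default = 0 := h1.symm.trans (congrFun (congrArg Subtype.val hx) default)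
      have h3 : x = 0 := (relCochainUniqueEquiv (n + 1)).injective (by rw [map_zero]; exact h2)
      exact ⟨0, by rw [map_zero]; exact h3.symm⟩
    · refine ⟨(relCochainUniqueEquiv n).symm (x.1 default), ?_⟩
      refine (relCochainUniqueEquiv (n + 1)).injective ?_
      refine (relCoboundary_apply _ (SimplexFamily.mem_of_univ Y default)).trans ?_
      rw [coboundary_of_unique, if_neg hn]
      rfl

end point

/-- The cohomology of a real topological vector space. -/
theorem relCohomology_of_vectorSpace (E : Type u) [AddCommGroup E] [Module ℝ E]
    [TopologicalSpace E] [ContinuousSMul ℝ E] :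
    Nonempty (relCohomology (SimplexFamily.of (Set.univ : Set E)) (SimplexFamily.of ∅) 0 ≃ₗ[ℤ] ℤ) ∧
    ∀ n, Subsingleton
      (relCohomology (SimplexFamily.of (Set.univ : Set E)) (SimplexFamily.of ∅) (n + 1)) := by
  have h : Continuous fun p : E × stdSimplex ℝ (Fin 2) => (p.2 1 : ℝ) • p.1 :=
    ((continuous_apply (1 : Fin 2)).comp (continuous_subtype_val.comp continuous_snd)).smul
      continuous_fst
  have key := fun n => nonempty_relCohomology_equiv_of_retract (S := (Set.univ : Set E)) (T := ∅)
    (S' := (Set.univ : Set PUnit.{u + 1})) (T' := ∅) (ContinuousMap.const _ 0)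
    (ContinuousMap.const _ PUnit.unit) ⟨_, h⟩ (fun _ _ _ => trivial) (fun _ h => h.elim)
    (fun x => by simp) (fun x => by simp) (fun _ => rfl) (fun _ _ => trivial) (fun _ h => h.elim)
    (fun _ _ => trivial) (fun _ h => h.elim) n
  obtain ⟨⟨e0⟩, h1⟩ := relCohomology_of_unique (Y := PUnit.{u + 1})
  exact ⟨⟨(key 0).some.trans e0⟩, fun n => (key (n + 1)).some.toEquiv.subsingleton_congr.2 (h1 n)⟩

/-! ### The Gysin sequence -/

section gysin

/-- Graded groups that are free of finite rank and vanish in degrees not divisible by three. -/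
structure IsThreeConcentrated (H : ℕ → ModuleCat.{u} ℤ) : Prop where
  free : ∀ d, Module.Free ℤ (H d)
  finite : ∀ d, Module.Finite ℤ (H d)
  subsingleton : ∀ d, ¬ 3 ∣ d → Subsingleton (H d)

/-- An additive equivalence is `ℤ`-linear for any module structures. -/
def AddEquiv.intLinearEquiv {A B : Type*} [AddCommGroup A] [AddCommGroup B] [Module ℤ A]
    [Module ℤ B] (e : A ≃+ B) : A ≃ₗ[ℤ] B :=
  { e with map_smul' := fun c x => map_intCast_smul e ℤ ℤ c x }

/-- A surjection onto a free group splits. The conclusion is only additive, which avoids fixing a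
`ℤ`-module structure on the product; `AddEquiv.intLinearEquiv` restores linearity. -/
theorem Function.Exact.nonempty_addEquiv_prod {A B C : Type*} [AddCommGroup A] [AddCommGroup B]
    [AddCommGroup C] [Module ℤ A] [Module ℤ B] [Module ℤ C] [Module.Free ℤ C] {f : A →ₗ[ℤ] B}
    {g : B →ₗ[ℤ] C} (h : Function.Exact f g) (hf : Function.Injective f)
    (hg : Function.Surjective g) : Nonempty (B ≃+ A × C) := by
  obtain ⟨l, hl⟩ := Module.projective_lifting_property g LinearMap.id hg
  let _ : Module ℤ (A × C) := Prod.instModule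
  exact ⟨(h.splitSurjectiveEquiv hf ⟨l, hl⟩).1.toAddEquiv⟩

theorem AddEquiv.free_and_finite_of_prod {A B C : Type*} [AddCommGroup A] [AddCommGroup B]
    [AddCommGroup C] [mA : Module ℤ A] [mB : Module ℤ B] [mC : Module ℤ C] [Module.Free ℤ B]
    [Module.Finite ℤ B] [Module.Free ℤ C] [Module.Finite ℤ C] (e : A ≃+ B × C) :
    Module.Free ℤ A ∧ Module.Finite ℤ A := by
  let _ := @Prod.instModule ℤ B C _ _ _ mB mC
  have h1 : Module.Free ℤ (B × C) := Module.Free.prod ℤ B C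
  have h2 : Module.Finite ℤ (B × C) := Module.Finite.prod
  exact ⟨Module.Free.of_equiv e.symm.intLinearEquiv, Module.Finite.equiv e.symm.intLinearEquiv⟩

/-- The complement of a trivially embedded subspace of real codimension four: an algebraic
consequence of the Gysin sequence for cohomology concentrated in degrees divisible by three. -/
theorem isThreeConcentrated_of_gysin {H K N T : ℕ → ModuleCat.{u} ℤ}
    (a : ∀ n, T n →ₗ[ℤ] H n) (b : ∀ n, H n →ₗ[ℤ] K n) (δ : ∀ n, K n →ₗ[ℤ] T (n + 1))
    (hab : ∀ n, Function.Exact (a n) (b n)) (hbδ : ∀ n, Function.Exact (b n) (δ n))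
    (hδa : ∀ n, Function.Exact (δ n) (a (n + 1)))
    (hT : ∀ n, Nonempty (T (n + 4) ≃ₗ[ℤ] N n)) (hT0 : ∀ n < 4, Subsingleton (T n))
    (hH : IsThreeConcentrated H) (hN : IsThreeConcentrated N) :
    IsThreeConcentrated K ∧ (∀ d < 3, Nonempty (K d ≃ₗ[ℤ] H d)) ∧
      ∀ d, Nonempty (K (d + 3) ≃+ H (d + 3) × N d) := by
  have hTfree : ∀ n, Module.Free ℤ (T n) ∧ Module.Finite ℤ (T n) := by
    intro n
    rcases lt_or_ge n 4 with hn | hn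
    · have := hT0 n hn
      exact ⟨inferInstance, inferInstance⟩
    · obtain ⟨m, rfl⟩ := Nat.exists_eq_add_of_le' hn
      obtain ⟨e⟩ := hT m
      have := hN.free m
      have := hN.finite m
      exact ⟨Module.Free.of_equiv e.symm, Module.Finite.equiv e.symm⟩
  -- `T` is `N` shifted by four, so it lives in degrees congruent to 1 modulo 3.
  have hTsub : ∀ n, ¬ 3 ∣ n + 2 → Subsingleton (T n) := by
    intro n h
    rcases lt_or_ge n 4 with hn | hn
    · exact hT0 n hn
    · obtain ⟨m, rfl⟩ := Nat.exists_eq_add_of_le' hn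
      have := hN.subsingleton m (by omega)
      exact (hT m).some.toEquiv.subsingleton_congr.2 this
  have hKsub : ∀ n, ¬ 3 ∣ n → Subsingleton (K n) := by
    intro n hn
    have h1 := hH.subsingleton n hn
    have h2 := hTsub (n + 1) (by omega)
    refine subsingleton_of_forall_eq 0 fun x => ?_
    obtain ⟨y, rfl⟩ := (hbδ n x).1 (Subsingleton.elim _ _)
    rw [Subsingleton.elim y 0, map_zero]
  have hKprod : ∀ n, Nonempty (K n ≃+ H n × T (n + 1)) := by
    intro n
    -- If 3 divides `n`, then `T n` and `H (n + 1)` vanish, leaving a short exact sequence with free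
    -- quotient `T (n + 1)`. Otherwise all three groups vanish.
    by_cases hn : 3 ∣ n
    · have h1 := hTsub n (by omega)
      have h2 := hH.subsingleton (n + 1) (by omega)
      have := (hTfree (n + 1)).1
      refine (hbδ n).nonempty_addEquiv_prod ?_ fun x => (hδa n x).1 (Subsingleton.elim _ _)
      rw [injective_iff_map_eq_zero]
      intro x hx
      obtain ⟨y, rfl⟩ := (hab n x).1 hx
      rw [Subsingleton.elim y 0, map_zero]
    · have h1 := hH.subsingleton n hn
      have h2 := hTsub (n + 1) (by omega)
      have h3 := hKsub n hn
      exact ⟨⟨equivOfSubsingletonOfSubsingleton 0 0, fun _ _ => Subsingleton.elim _ _⟩⟩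
  have hKfree : ∀ n, Module.Free ℤ (K n) ∧ Module.Finite ℤ (K n) := by
    intro n
    have := hH.free n
    have := hH.finite n
    have := (hTfree (n + 1)).1
    have := (hTfree (n + 1)).2
    exact (hKprod n).some.free_and_finite_of_prod
  refine ⟨⟨fun n => (hKfree n).1, fun n => (hKfree n).2, hKsub⟩, fun d hd => ?_, fun d => ?_⟩
  · have := hT0 (d + 1) (by omega)
    have : Unique (T (d + 1)) := ⟨⟨0⟩, fun _ => Subsingleton.elim _ _⟩
    exact ⟨((hKprod d).some.trans AddEquiv.prodUnique).intLinearEquiv⟩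
  · exact ⟨(hKprod (d + 3)).some.trans ((AddEquiv.refl _).prodCongr (hT d).some.toAddEquiv)⟩

theorem IsThreeConcentrated.of_equiv {H K : ℕ → ModuleCat.{u} ℤ} (hH : IsThreeConcentrated H)
    (e : ∀ n, Nonempty (K n ≃ₗ[ℤ] H n)) : IsThreeConcentrated K where
  free n := have := hH.free n; Module.Free.of_equiv (e n).some.symm
  finite n := have := hH.finite n; Module.Finite.equiv (e n).some.symm
  subsingleton n hn :=
    have := hH.subsingleton n hn; (e n).some.toEquiv.subsingleton_congr.2 this

/-- The cohomology of the complement of a subspace with a trivial tubular neighbourhood of real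
codimension four. -/
theorem singularCohomology_of_tube {V Y : Type u} [TopologicalSpace V] [TopologicalSpace Y]
    {Ω M : Set V} (hM : IsOpen M) {j : (((Y × ℝ) × ℝ) × ℝ) × ℝ → V}
    (hj : Topology.IsOpenEmbedding j) (hjM : j ⁻¹' M = offZeroSection Y)
    (hΩ : Set.range j ∪ M = Ω)
    (hcΩ : IsThreeConcentrated (singularCohomology Ω))
    (hcY : IsThreeConcentrated (singularCohomology Y)) :
    IsThreeConcentrated (singularCohomology M) ∧
      (∀ d < 3, Nonempty (singularCohomology M d ≃ₗ[ℤ] singularCohomology Ω d)) ∧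
      ∀ d, Nonempty (singularCohomology M (d + 3) ≃+
        singularCohomology Ω (d + 3) × singularCohomology Y d) := by
  have eΩ := nonempty_singularCohomology_subtype_equiv Ω
  have eM := nonempty_singularCohomology_subtype_equiv M
  have eY := nonempty_singularCohomology_equiv Y
  have hMΩ : M ⊆ Ω := hΩ ▸ Set.subset_union_right
  obtain ⟨a, b, δ, h1, h2, h3, -⟩ := exists_long_exact_sequence (P := SimplexFamily.of Ω)
    (Q := SimplexFamily.of M) (R := SimplexFamily.of ∅) (of_mono (Set.empty_subset _))
    (of_mono hMΩ)
  obtain ⟨t1, t2⟩ := relCohomology_offZeroSection (Y := Y)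
  have hT : ∀ n, Nonempty (relCohomology (SimplexFamily.of Ω) (SimplexFamily.of M) n ≃ₗ[ℤ]
      relCohomology (SimplexFamily.of (Set.univ : Set ((((Y × ℝ) × ℝ) × ℝ) × ℝ)))
        (SimplexFamily.of (offZeroSection Y)) n) := by
    intro n
    -- Excision shrinks the ambient space to the tube, whose pair the embedding identifies with the
    -- trivial bundle off its zero section.
    obtain ⟨e1⟩ := nonempty_excision hj.isOpen_range hM n
    obtain ⟨e2⟩ := nonempty_relCohomology_equiv_of_isEmbedding (j := ⟨j, hj.continuous⟩)
      hj.isEmbedding M n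
    rw [hΩ] at e1
    rw [← hjM]
    exact ⟨e1.trans e2⟩
  obtain ⟨c1, c2, c3⟩ := isThreeConcentrated_of_gysin a b δ h1 h2 h3
    (fun n => ⟨(hT (n + 4)).some.trans (t1 n).some⟩)
    (fun n hn => (hT n).some.toEquiv.subsingleton_congr.2 (t2 n hn))
    (hcΩ.of_equiv fun n => ⟨(eΩ n).some.symm⟩) (hcY.of_equiv fun n => ⟨(eY n).some.symm⟩)
  refine ⟨c1.of_equiv eM, fun d hd => ?_, fun d => ?_⟩
  · exact ⟨(eM d).some.trans ((c2 d hd).some.trans (eΩ d).some.symm)⟩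
  · exact ⟨(eM (d + 3)).some.toAddEquiv.trans ((c3 d).some.trans
      ((eΩ (d + 3)).some.symm.toAddEquiv.prodCongr (eY d).some.symm.toAddEquiv))⟩

end gysin

open MulOpposite

/-! ### Hyperplanes, functionals and complements -/

section functionals

variable {V : Type u} [AddCommGroup V] [Module ℍ[ℝ]ᵐᵒᵖ V]

theorem finrank_quaternion_mulOpposite : Module.finrank ℍ[ℝ]ᵐᵒᵖ ℍ[ℝ] = 1 :=
  finrank_eq_one (1 : ℍ[ℝ]) one_ne_zero fun w => ⟨op w, by rw [op_smul_eq_mul, one_mul]⟩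

/-- A hyperplane is the kernel of a linear functional. -/
theorem exists_functional (H : Submodule ℍ[ℝ]ᵐᵒᵖ V)
    (h : Module.finrank ℍ[ℝ]ᵐᵒᵖ (V ⧸ H) = 1) :
    ∃ α : V →ₗ[ℍ[ℝ]ᵐᵒᵖ] ℍ[ℝ], LinearMap.ker α = H := by
  have h1 : Module.Finite ℍ[ℝ]ᵐᵒᵖ (V ⧸ H) :=
    Module.finite_of_finrank_pos (by rw [h]; exact one_pos)
  have h2 : Module.Finite ℍ[ℝ]ᵐᵒᵖ ℍ[ℝ] :=
    Module.finite_of_finrank_pos (by rw [finrank_quaternion_mulOpposite]; exact one_pos)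
  obtain ⟨e⟩ := FiniteDimensional.nonempty_linearEquiv_of_finrank_eq
    (h.trans finrank_quaternion_mulOpposite.symm)
  exact ⟨e.toLinearMap ∘ₗ H.mkQ, by rw [LinearEquiv.ker_comp, Submodule.ker_mkQ]⟩

/-- The real vector space underlying a right quaternionic vector space. -/
abbrev realModule (V : Type u) [AddCommGroup V] [Module ℍ[ℝ]ᵐᵒᵖ V] : Module ℝ V :=
  Module.compHom V (algebraMap ℝ ℍ[ℝ]ᵐᵒᵖ)

theorem sub_smul_mem_ker (α : V →ₗ[ℍ[ℝ]ᵐᵒᵖ] ℍ[ℝ]) {v : V} (hv : α v = 1) (z : V) :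
    z - op (α z) • v ∈ LinearMap.ker α := by
  rw [LinearMap.mem_ker, map_sub, map_smul, hv, op_smul_eq_mul, one_mul, sub_self]

variable [TopologicalSpace V]

theorem continuousSMul_real [ContinuousSMul ℍ[ℝ]ᵐᵒᵖ V] :
    letI := realModule V
    ContinuousSMul ℝ V := by
  let _ := realModule V
  refine ⟨?_⟩
  exact (((continuous_algebraMap ℝ ℍ[ℝ]ᵐᵒᵖ).comp continuous_fst).smul continuous_snd :
    Continuous fun p : ℝ × V => algebraMap ℝ ℍ[ℝ]ᵐᵒᵖ p.1 • p.2)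

/-- Over `ℝ` the space is still finite-dimensional and Hausdorff, and there every linear map is
continuous. -/
theorem continuous_functional [FiniteDimensional ℍ[ℝ]ᵐᵒᵖ V] [IsTopologicalAddGroup V]
    [ContinuousSMul ℍ[ℝ]ᵐᵒᵖ V] [T2Space V] (α : V →ₗ[ℍ[ℝ]ᵐᵒᵖ] ℍ[ℝ]) : Continuous α := by
  let _ := realModule V
  have := continuousSMul_real (V := V)
  have : IsScalarTower ℝ ℍ[ℝ]ᵐᵒᵖ V := IsScalarTower.of_algebraMap_smul fun _ _ => rfl
  have : Module.Finite ℝ ℍ[ℝ]ᵐᵒᵖ := Module.Finite.equiv (opLinearEquiv ℝ)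
  have : FiniteDimensional ℝ V := Module.Finite.trans ℍ[ℝ]ᵐᵒᵖ V
  let β : V →ₗ[ℝ] ℍ[ℝ] :=
    { toFun := α
      map_add' := map_add α
      map_smul' := fun r v => by
        change α (algebraMap ℝ ℍ[ℝ]ᵐᵒᵖ r • v) = r • α v
        rw [map_smul, algebraMap_smul] }
  exact LinearMap.continuous_of_finiteDimensional β

end functionals

namespace CentralArrangement

variable {V : Type u} [AddCommGroup V] [Module ℍ[ℝ]ᵐᵒᵖ V]

theorem mem_complement {A : CentralArrangement V} {v : V} :
    v ∈ A.complement ↔ ∀ H ∈ A.hyperplanes, v ∉ H := by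
  simp [complement]

theorem isCoatom {A : CentralArrangement V} {H : Submodule ℍ[ℝ]ᵐᵒᵖ V} (hH : H ∈ A.hyperplanes) :
    IsCoatom H :=
  isSimpleModule_iff_isCoatom.1 (isSimpleModule_iff_finrank_eq_one.2 (A.codim_eq_one H hH))

/-- Hyperplanes are coatoms, so distinct ones are incomparable. Hence the restriction to `H₀`
discards `H₀` alone. -/
theorem not_le {A : CentralArrangement V} {H₀ H : Submodule ℍ[ℝ]ᵐᵒᵖ V} (h₀ : H₀ ∈ A.hyperplanes)
    (hH : H ∈ A.hyperplanes) (hne : H ≠ H₀) : ¬ H₀ ≤ H := fun hle =>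
  (A.isCoatom hH).1 ((A.isCoatom h₀).2 H (lt_of_le_of_ne hle hne.symm))

theorem mem_complement_restriction {A : CentralArrangement V} {H₀ : Submodule ℍ[ℝ]ᵐᵒᵖ V}
    (h₀ : H₀ ∈ A.hyperplanes) (x : H₀) :
    x ∈ (A.restriction H₀).complement ↔ (x : V) ∈ (A.deletion H₀).complement := by
  rw [mem_complement, mem_complement]
  constructor
  · intro h H hH hx
    exact h (H.comap H₀.subtype) ⟨H, ⟨hH.1, not_le h₀ hH.1 hH.2⟩, rfl⟩ hx
  · rintro h _ ⟨H, ⟨hH, hle⟩, rfl⟩ hx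
    exact h H ⟨hH, fun he => hle (he ▸ le_rfl)⟩ hx

theorem mem_complement_iff {A : CentralArrangement V} {H₀ : Submodule ℍ[ℝ]ᵐᵒᵖ V}
    (h₀ : H₀ ∈ A.hyperplanes) (v : V) :
    v ∈ A.complement ↔ v ∈ (A.deletion H₀).complement ∧ v ∉ H₀ := by
  rw [mem_complement, mem_complement]
  refine ⟨fun h => ⟨fun H hH => h H hH.1, h H₀ h₀⟩, fun h H hH => ?_⟩
  by_cases he : H = H₀
  · exact he ▸ h.2
  · exact h.1 H ⟨hH, he⟩

variable [FiniteDimensional ℍ[ℝ]ᵐᵒᵖ V] [TopologicalSpace V] [IsTopologicalAddGroup V]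
  [ContinuousSMul ℍ[ℝ]ᵐᵒᵖ V] [T2Space V]

theorem isOpen_complement (A : CentralArrangement V) : IsOpen A.complement := by
  refine (A.finite_hyperplanes.isClosed_biUnion fun H hH => ?_).isOpen_compl
  obtain ⟨α, rfl⟩ := exists_functional H (A.codim_eq_one H hH)
  exact isClosed_singleton.preimage (continuous_functional α)

end CentralArrangement

/-! ### The trivial tubular neighbourhood -/

section tube

/-- The coordinates of a quaternion. -/
def quaternionCoordHomeomorph (Y : Type u) [TopologicalSpace Y] :
    (((Y × ℝ) × ℝ) × ℝ) × ℝ ≃ₜ Y × ℍ[ℝ] where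
  toFun p := (p.1.1.1.1, ⟨p.1.1.1.2, p.1.1.2, p.1.2, p.2⟩)
  invFun p := ((((p.1, p.2.re), p.2.imI), p.2.imJ), p.2.imK)
  left_inv _ := rfl
  right_inv _ := rfl
  continuous_toFun := by
    have h : Continuous fun p : (((Y × ℝ) × ℝ) × ℝ) × ℝ =>
        linearIsometryEquivTuple.symm (!₂[p.1.1.1.2, p.1.1.2, p.1.2, p.2]) := by
      refine linearIsometryEquivTuple.symm.continuous.comp
        ((PiLp.continuous_toLp 2 _).comp (continuous_pi fun i => ?_))
      fin_cases i
      · exact continuous_snd.comp (continuous_fst.comp (continuous_fst.comp continuous_fst))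
      · exact continuous_snd.comp (continuous_fst.comp continuous_fst)
      · exact continuous_snd.comp continuous_fst
      · exact continuous_snd
    exact (continuous_fst.comp (continuous_fst.comp (continuous_fst.comp continuous_fst))).prodMk h
  continuous_invFun :=
    (((continuous_fst.prodMk (continuous_re.comp continuous_snd)).prodMk
      (continuous_imI.comp continuous_snd)).prodMk (continuous_imJ.comp continuous_snd)).prodMk
        (continuous_imK.comp continuous_snd)

theorem mem_offZeroSection_iff {Y : Type u} [TopologicalSpace Y]
    (p : (((Y × ℝ) × ℝ) × ℝ) × ℝ) :
    p ∈ offZeroSection Y ↔ (quaternionCoordHomeomorph Y p).2 ≠ 0 := by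
  rw [Ne, Quaternion.ext_iff]
  change (((False ∨ _) ∨ _) ∨ _) ∨ _ ↔ ¬ (p.1.1.1.2 = 0 ∧ p.1.1.2 = 0 ∧ p.1.2 = 0 ∧ p.2 = 0)
  tauto

/-- Rescaling of the fibres of a trivial bundle. -/
def fibreScale {Y E : Type*} [TopologicalSpace Y] [NormedAddCommGroup E] [NormedSpace ℝ E]
    (ε : Y → ℝ) (hε : Continuous ε) (h0 : ∀ y, ε y ≠ 0) : Y × E ≃ₜ Y × E where
  toFun p := (p.1, ε p.1 • p.2)
  invFun p := (p.1, (ε p.1)⁻¹ • p.2)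
  left_inv p := by simp [smul_smul, h0]
  right_inv p := by simp [smul_smul, h0]
  continuous_toFun := continuous_fst.prodMk ((hε.comp continuous_fst).smul continuous_snd)
  continuous_invFun :=
    continuous_fst.prodMk (((hε.comp continuous_fst).inv₀ fun _ => h0 _).smul continuous_snd)

variable {V : Type u} [AddCommGroup V] [Module ℍ[ℝ]ᵐᵒᵖ V] [TopologicalSpace V]
  [IsTopologicalAddGroup V] [ContinuousSMul ℍ[ℝ]ᵐᵒᵖ V]

/-- The splitting of a space as the kernel of a functional plus a line. -/
def kerProdHomeomorph (α : V →ₗ[ℍ[ℝ]ᵐᵒᵖ] ℍ[ℝ]) (hα : Continuous α) (v : V) (hv : α v = 1) :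
    LinearMap.ker α × ℍ[ℝ] ≃ₜ V where
  toFun p := p.1 + op p.2 • v
  invFun z := (⟨z - op (α z) • v, sub_smul_mem_ker α hv z⟩, α z)
  left_inv p := by
    have h1 : α (p.1 + op p.2 • v) = p.2 := by
      rw [map_add, map_smul, hv, op_smul_eq_mul, one_mul, LinearMap.mem_ker.1 p.1.2, zero_add]
    refine Prod.ext (Subtype.ext ?_) h1
    change p.1 + op p.2 • v - op (α (p.1 + op p.2 • v)) • v = p.1
    rw [h1, add_sub_cancel_right]
  right_inv z := sub_add_cancel z (op (α z) • v)
  continuous_toFun := (continuous_subtype_val.comp continuous_fst).add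
    ((continuous_op.comp continuous_snd).smul continuous_const)
  continuous_invFun := (Continuous.subtype_mk
    (continuous_id.sub ((continuous_op.comp hα).smul continuous_const))
      (sub_smul_mem_ker α hv)).prodMk hα

namespace CentralArrangement

variable [FiniteDimensional ℍ[ℝ]ᵐᵒᵖ V] [T2Space V]

/-- The hyperplane `H₀` has a trivial tubular neighbourhood in the complement of the others. -/
theorem exists_tube (A : CentralArrangement V) {H₀ : Submodule ℍ[ℝ]ᵐᵒᵖ V}
    (h₀ : H₀ ∈ A.hyperplanes) :
    ∃ j : ((((A.restriction H₀).complement × ℝ) × ℝ) × ℝ) × ℝ → V, Topology.IsOpenEmbedding j ∧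
      j ⁻¹' A.complement = offZeroSection (A.restriction H₀).complement ∧
      Set.range j ∪ A.complement = (A.deletion H₀).complement := by
  classical
  have hfun : ∀ H : Submodule ℍ[ℝ]ᵐᵒᵖ V, ∃ α : V →ₗ[ℍ[ℝ]ᵐᵒᵖ] ℍ[ℝ],
      H ∈ A.hyperplanes → LinearMap.ker α = H := fun H => by
    by_cases hH : H ∈ A.hyperplanes
    · obtain ⟨α, h⟩ := exists_functional H (A.codim_eq_one H hH)
      exact ⟨α, fun _ => h⟩
    · exact ⟨0, fun h => absurd h hH⟩
  choose α hα using hfun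
  obtain ⟨β, hβ⟩ := exists_functional H₀ (A.codim_eq_one H₀ h₀)
  subst hβ
  obtain ⟨v, hv⟩ : ∃ v, β v = 1 := by
    obtain ⟨w, hw⟩ : ∃ w, β w ≠ 0 := by
      by_contra! h
      exact (A.isCoatom h₀).1 (LinearMap.ker_eq_top.2 (LinearMap.ext h))
    exact ⟨op (β w)⁻¹ • w, by rw [map_smul, op_smul_eq_mul, mul_inv_cancel₀ hw]⟩
  set H₀ := LinearMap.ker β
  set N := (A.restriction H₀).complement with hN
  -- Adding 1 keeps the divisor positive even when `v` lies in `H`, and makes the inequality in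
  -- `hmem` strict.
  let C : Submodule ℍ[ℝ]ᵐᵒᵖ V → ℝ := fun H => 1 + ‖α H v‖
  have hC : ∀ H, 0 < C H := fun H => by positivity
  let s := (A.deletion H₀).finite_hyperplanes.toFinset
  have hs : ∀ {H}, H ∈ s ↔ H ∈ A.hyperplanes ∧ H ≠ H₀ := by
    intro H
    exact (A.deletion H₀).finite_hyperplanes.mem_toFinset
  -- The radius of the tube over `x`. Truncating each factor at 1 makes the product at most each
  -- factor, while a finite product stays continuous and positive.
  let ε : N → ℝ := fun x => ∏ H ∈ s, min 1 (‖α H x.1‖ / C H)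
  have hεc : Continuous ε := by
    refine continuous_finsetProd _ fun H _ => continuous_const.min (Continuous.div_const ?_ _)
    exact (continuous_functional (α H)).norm.comp
      (continuous_subtype_val.comp continuous_subtype_val)
  have hne : ∀ (x : N), ∀ H ∈ s, α H x.1 ≠ 0 := by
    intro x H hH h
    have h1 := (mem_complement_restriction h₀ x.1).1 x.2
    refine mem_complement.1 h1 H (hs.1 hH) ?_
    rw [← hα H (hs.1 hH).1]
    exact h
  have hε0 : ∀ x, 0 < ε x := fun x => Finset.prod_pos fun H hH =>
    lt_min one_pos (div_pos (norm_pos_iff.2 (hne x H hH)) (hC H))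
  have hεle : ∀ (x : N), ∀ H ∈ s, ε x ≤ ‖α H x.1‖ / C H := by
    intro x H hH
    refine le_trans ?_ (min_le_right 1 _)
    rw [show ε x = _ from (Finset.mul_prod_erase s
      (fun H => min 1 (‖α H x.1‖ / C H)) hH).symm]
    refine mul_le_of_le_one_right (le_min zero_le_one (by have := hC H; positivity))
      (Finset.prod_le_one (fun H _ => le_min zero_le_one (by have := hC H; positivity))
        fun _ _ => min_le_left _ _)
  -- If `α H` vanished at `x + v y`, then `‖α H x‖ = ‖α H v‖ ‖y‖`, whereas the choice of `ε` gives
  -- `(1 + ‖α H v‖) ‖y‖ < ‖α H x‖`.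
  have hmem : ∀ (x : N) (y : ℍ[ℝ]), ‖y‖ < ε x →
      (x.1 : V) + op y • v ∈ (A.deletion H₀).complement := by
    intro x y hy
    refine mem_complement.2 fun H hH h => ?_
    rw [← hα H hH.1, LinearMap.mem_ker, map_add, map_smul, op_smul_eq_mul] at h
    have h1 := hy.trans_le (hεle x H (hs.2 hH))
    rw [lt_div_iff₀ (hC H), eq_neg_of_add_eq_zero_left h, norm_neg, norm_mul] at h1
    have := norm_nonneg y
    simp only [C] at h1
    nlinarith
  -- Compressing `ℍ` onto its open unit ball, with 0 fixed, turns the tube of variable radius into a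
  -- full product with `ℍ`.
  let e := OpenPartialHomeomorph.univUnitBall (E := ℍ[ℝ])
  have he : Topology.IsOpenEmbedding e := e.isOpenEmbedding rfl
  have he0 : ∀ q, e q = 0 ↔ q = 0 := fun q => by
    have h : e 0 = 0 := OpenPartialHomeomorph.univUnitBall_apply_zero
    rw [← he.injective.eq_iff (a := q), h]
  have he1 : ∀ q, ‖e q‖ < 1 := fun q => by
    have h : e q ∈ Metric.ball (0 : ℍ[ℝ]) 1 := e.map_source (x := q) trivial
    simpa using h
  let Ψ := kerProdHomeomorph β (continuous_functional β) v hv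
  let F : N × ℍ[ℝ] → V := fun p => Ψ (p.1.1, ε p.1 • e p.2)
  have hF : Topology.IsOpenEmbedding F := by
    have hNo : IsOpen N := by
      refine isOpen_iff_mem_nhds.2 fun x hx => ?_
      have ho := (A.deletion H₀).isOpen_complement.preimage (continuous_subtype_val (p := (· ∈ H₀)))
      exact Filter.mem_of_superset (ho.mem_nhds ((mem_complement_restriction h₀ x).1 hx))
        fun y hy => (mem_complement_restriction h₀ y).2 hy
    exact Ψ.isOpenEmbedding.comp
      ((hNo.isOpenEmbedding_subtypeVal.prodMap Topology.IsOpenEmbedding.id).comp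
        ((fibreScale ε hεc fun x => (hε0 x).ne').isOpenEmbedding.comp
          (Topology.IsOpenEmbedding.id.prodMap he)))
  have hFdel : ∀ p, F p ∈ (A.deletion H₀).complement := fun p => by
    refine hmem p.1 _ ?_
    rw [norm_smul, Real.norm_of_nonneg (hε0 _).le]
    exact mul_lt_of_lt_one_right (hε0 _) (he1 _)
  have hFH : ∀ p, F p ∈ H₀ ↔ p.2 = 0 := fun p => by
    have h1 : β (F p) = ε p.1 • e p.2 := congrArg Prod.snd (Ψ.symm_apply_apply _)
    rw [LinearMap.mem_ker, h1, smul_eq_zero, he0]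
    simp [(hε0 p.1).ne']
  refine ⟨F ∘ quaternionCoordHomeomorph N,
    hF.comp (quaternionCoordHomeomorph N).isOpenEmbedding, ?_, ?_⟩
  · ext p
    rw [mem_offZeroSection_iff, Set.mem_preimage, mem_complement_iff h₀, Function.comp_apply, hFH]
    exact and_iff_right (hFdel _)
  · ext z
    rw [Set.mem_union, mem_complement_iff h₀]
    constructor
    · rintro (⟨p, rfl⟩ | h)
      · exact hFdel _
      · exact h.1
    · intro hz
      by_cases hzH : z ∈ H₀
      · refine Or.inl ⟨(quaternionCoordHomeomorph N).symm
          (⟨⟨z, hzH⟩, (mem_complement_restriction h₀ _).2 hz⟩, 0), ?_⟩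
        rw [Function.comp_apply, Homeomorph.apply_symm_apply]
        change z + op (ε _ • e 0) • v = z
        rw [(he0 0).2 rfl, smul_zero, op_zero, zero_smul, add_zero]
      · exact Or.inr ⟨hz, hzH⟩

end CentralArrangement

end tube

namespace CentralArrangement

/-! ### The Möbius function and the lattice polynomial -/

section combinatorics

variable {V : Type u} [AddCommGroup V] [Module ℍ[ℝ]ᵐᵒᵖ V]

/-- The intersection of a subfamily of the hyperplanes, as an element of the lattice. -/
def flatOf {A : CentralArrangement V} {ι : Type*} {φ : ι → Submodule ℍ[ℝ]ᵐᵒᵖ V}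
    (T : Finset ι) (hT : ∀ i ∈ T, φ i ∈ A.hyperplanes) : A.IntersectionLattice :=
  ⟨OrderDual.toDual (T.inf φ), φ '' T, by rintro _ ⟨i, hi, rfl⟩; exact hT i hi, by
    rw [OrderDual.ofDual_toDual, Finset.inf_eq_iInf, sInf_image]; rfl⟩

namespace IntersectionLattice

variable {A : CentralArrangement V}

theorem toSubmodule_injective :
    Function.Injective (toSubmodule : A.IntersectionLattice → Submodule ℍ[ℝ]ᵐᵒᵖ V) :=
  fun _ _ h => Subtype.ext h

theorem le_iff {X Y : A.IntersectionLattice} : X ≤ Y ↔ Y.toSubmodule ≤ X.toSubmodule := Iff.rfl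

theorem sum_Icc_moebius (X : A.IntersectionLattice) :
    ∑ Y ∈ Finset.Icc ⊥ X, Y.moebius = if X = ⊥ then 1 else 0 := by
  rw [show (∑ Y ∈ Finset.Icc ⊥ X, Y.moebius) = ∑ Y ∈ Finset.Icc ⊥ X, IncidenceAlgebra.mu ℤ ⊥ Y
    from rfl, IncidenceAlgebra.sum_Icc_mu_right]
  simp only [eq_comm]

/-- The sums over intervals determine a function recursively from the bottom, so they characterize
the Möbius function. -/
theorem eq_moebius_of_sum_Icc {f : A.IntersectionLattice → ℤ}
    (hf : ∀ X, ∑ Y ∈ Finset.Icc ⊥ X, f Y = if X = ⊥ then 1 else 0) (X : A.IntersectionLattice) :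
    X.moebius = f X := by
  induction X using WellFoundedLT.induction with
  | ind X ih =>
    have h := (sum_Icc_moebius X).trans (hf X).symm
    rw [Finset.Icc_eq_cons_Ico bot_le, Finset.sum_cons, Finset.sum_cons,
      Finset.sum_congr rfl fun Y hY => ih Y (Finset.mem_Ico.1 hY).2] at h
    exact add_right_cancel h

theorem eq_bot_iff_forall_not_le {X : A.IntersectionLattice} :
    X = ⊥ ↔ ∀ H ∈ A.hyperplanes, ¬ X.toSubmodule ≤ H := by
  constructor
  · rintro rfl H hH hle
    exact (A.isCoatom hH).1 (top_le_iff.1 hle)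
  · intro h
    obtain ⟨S, hS, hX⟩ := X.2
    refine toSubmodule_injective (hX.trans ?_)
    have hS0 : S = ∅ := Set.eq_empty_of_forall_notMem fun H hH =>
      h H (hS hH) (hX.le.trans (sInf_le hH))
    rw [hS0, sInf_empty]
    rfl

open Classical in
/-- The Möbius function as an alternating sum over subfamilies of the hyperplanes. -/
theorem moebius_eq_sum {ι : Type*} {s : Finset ι} {φ : ι → Submodule ℍ[ℝ]ᵐᵒᵖ V}
    (hφ : φ '' s = A.hyperplanes) (X : A.IntersectionLattice) :
    X.moebius = ∑ T ∈ s.powerset with T.inf φ = X.toSubmodule, (-1 : ℤ) ^ T.card := by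
  have hmem : ∀ T ∈ s.powerset, ∀ i ∈ T, φ i ∈ A.hyperplanes := fun T hT i hi =>
    hφ ▸ ⟨i, Finset.mem_powerset.1 hT hi, rfl⟩
  refine eq_moebius_of_sum_Icc
    (f := fun X => ∑ T ∈ s.powerset with T.inf φ = X.toSubmodule, (-1 : ℤ) ^ T.card) (fun X => ?_) X
  -- Each subfamily has exactly one intersection, so summing over `Y ≤ X` collects the subfamilies
  -- whose intersection contains `X`.
  have h1 : ∑ Y ∈ Finset.Icc ⊥ X, ∑ T ∈ s.powerset with T.inf φ = Y.toSubmodule, (-1 : ℤ) ^ T.card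
      = ∑ T ∈ s.powerset with X.toSubmodule ≤ T.inf φ, (-1 : ℤ) ^ T.card := by
    simp only [Finset.sum_filter]
    rw [Finset.sum_comm]
    refine Finset.sum_congr rfl fun T hT => ?_
    have hY : ∀ Y : A.IntersectionLattice,
        T.inf φ = Y.toSubmodule ↔ flatOf T (hmem T hT) = Y :=
      fun Y => (toSubmodule_injective.eq_iff (a := flatOf T (hmem T hT)) (b := Y))
    simp only [hY, Finset.sum_ite_eq, Finset.mem_Icc, bot_le, true_and]
    exact if_congr le_iff rfl rfl
  rw [h1]
  -- These are all the subsets of the set of hyperplanes through `X`; their alternating count is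
  -- zero unless that set is empty, which means that `X` is the whole space.
  have h2 : (s.powerset.filter fun T => X.toSubmodule ≤ T.inf φ) =
      (s.filter fun i => X.toSubmodule ≤ φ i).powerset := by
    ext T
    rw [Finset.mem_filter, Finset.mem_powerset, Finset.mem_powerset, Finset.le_inf_iff]
    exact ⟨fun h i hi => Finset.mem_filter.2 ⟨h.1 hi, h.2 i hi⟩, fun h =>
      ⟨h.trans (Finset.filter_subset _ _), fun i hi => (Finset.mem_filter.1 (h hi)).2⟩⟩
  rw [h2, Finset.sum_powerset_neg_one_pow_card]
  refine if_congr ?_ rfl rfl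
  rw [eq_bot_iff_forall_not_le, Finset.filter_eq_empty_iff, ← hφ]
  simp

end IntersectionLattice

/-- Whitney's formula. The family `φ` may repeat a hyperplane; this is needed for restrictions,
since different hyperplanes can have the same trace on `H₀`. -/
theorem latticePolynomial_eq_sum (A : CentralArrangement V) {ι : Type*} {s : Finset ι}
    {φ : ι → Submodule ℍ[ℝ]ᵐᵒᵖ V} (hφ : φ '' s = A.hyperplanes) :
    A.latticePolynomial = ∑ T ∈ s.powerset,
      Polynomial.monomial (Module.finrank ℍ[ℝ]ᵐᵒᵖ (V ⧸ T.inf φ))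
        ((-1) ^ Module.finrank ℍ[ℝ]ᵐᵒᵖ (V ⧸ T.inf φ) * (-1) ^ T.card) := by
  classical
  have hmem : ∀ T ∈ s.powerset, ∀ i ∈ T, φ i ∈ A.hyperplanes := fun T hT i hi =>
    hφ ▸ ⟨i, Finset.mem_powerset.1 hT hi, rfl⟩
  have h : ∀ X : A.IntersectionLattice,
      Polynomial.monomial X.rk ((-1) ^ X.rk * X.moebius) =
        ∑ T ∈ s.powerset, if T.inf φ = X.toSubmodule then
          Polynomial.monomial (Module.finrank ℍ[ℝ]ᵐᵒᵖ (V ⧸ T.inf φ))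
        ((-1 : ℤ) ^ Module.finrank ℍ[ℝ]ᵐᵒᵖ (V ⧸ T.inf φ) * (-1) ^ T.card) else 0 := by
    intro X
    rw [X.moebius_eq_sum hφ, Finset.mul_sum, map_sum, Finset.sum_filter]
    refine Finset.sum_congr rfl fun T _ => ?_
    by_cases hT : T.inf φ = X.toSubmodule
    · rw [if_pos hT, if_pos hT, hT, IntersectionLattice.rk]
    · rw [if_neg hT, if_neg hT]
  rw [latticePolynomial, Finset.sum_congr rfl fun X _ => h X, Finset.sum_comm]
  refine Finset.sum_congr rfl fun T hT => ?_
  rw [Finset.sum_eq_single (flatOf T (hmem T hT))]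
  · exact if_pos rfl
  · exact fun Y _ hY => if_neg fun he => hY (IntersectionLattice.toSubmodule_injective he.symm)
  · exact fun h => absurd (Finset.mem_univ _) h

theorem latticePolynomial_of_isEmpty {A : CentralArrangement V} (hA : A.hyperplanes = ∅) :
    A.latticePolynomial = 1 := by
  rw [A.latticePolynomial_eq_sum (s := (∅ : Finset (Submodule ℍ[ℝ]ᵐᵒᵖ V))) (φ := id) (by simp [hA])]
  have h : Module.finrank ℍ[ℝ]ᵐᵒᵖ (V ⧸ (⊤ : Submodule ℍ[ℝ]ᵐᵒᵖ V)) = 0 :=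
    Module.finrank_zero_of_subsingleton
  rw [Finset.powerset_empty, Finset.sum_singleton, Finset.inf_empty, h]
  simp

theorem finrank_quotient_inf [FiniteDimensional ℍ[ℝ]ᵐᵒᵖ V] {H₀ : Submodule ℍ[ℝ]ᵐᵒᵖ V}
    (h : Module.finrank ℍ[ℝ]ᵐᵒᵖ (V ⧸ H₀) = 1) (K : Submodule ℍ[ℝ]ᵐᵒᵖ V) :
    Module.finrank ℍ[ℝ]ᵐᵒᵖ (V ⧸ H₀ ⊓ K) =
      Module.finrank ℍ[ℝ]ᵐᵒᵖ (H₀ ⧸ K.comap H₀.subtype) + 1 := by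
  have h1 := (H₀ ⊓ K).finrank_quotient_add_finrank
  have h2 := (K.comap H₀.subtype).finrank_quotient_add_finrank
  have h3 := H₀.finrank_quotient_add_finrank
  have h4 := Submodule.finrank_map_subtype_eq H₀ (K.comap H₀.subtype)
  rw [Submodule.map_comap_subtype] at h4
  omega

/-- Subfamilies without `H₀` give the deletion. Those containing `H₀` correspond to subfamilies of
traces on `H₀`; adjoining `H₀` raises both rank and cardinality by one, so the signs cancel and a
factor `X` remains. -/
theorem latticePolynomial_deletion_restriction [FiniteDimensional ℍ[ℝ]ᵐᵒᵖ V]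
    (A : CentralArrangement V) {H₀ : Submodule ℍ[ℝ]ᵐᵒᵖ V} (h₀ : H₀ ∈ A.hyperplanes) :
    A.latticePolynomial = (A.deletion H₀).latticePolynomial +
      Polynomial.X * (A.restriction H₀).latticePolynomial := by
  classical
  let s := (A.deletion H₀).finite_hyperplanes.toFinset
  have hs : (s : Set (Submodule ℍ[ℝ]ᵐᵒᵖ V)) = A.hyperplanes \ {H₀} := Set.Finite.coe_toFinset _
  have h0s : H₀ ∉ s := fun h => (hs ▸ Finset.mem_coe.2 h : H₀ ∈ A.hyperplanes \ {H₀}).2 rfl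
  have hφ : (fun H => H.comap H₀.subtype) '' (s : Set (Submodule ℍ[ℝ]ᵐᵒᵖ V)) =
      (A.restriction H₀).hyperplanes := by
    rw [hs]
    refine congrArg _ (Set.ext fun H => ⟨fun h => ⟨h.1, not_le h₀ h.1 h.2⟩, fun h => ⟨h.1, ?_⟩⟩)
    rintro rfl
    exact h.2 le_rfl
  have hA : id '' ((insert H₀ s : Finset _) : Set (Submodule ℍ[ℝ]ᵐᵒᵖ V)) = A.hyperplanes := by
    rw [Set.image_id, Finset.coe_insert, hs, Set.insert_sdiff_singleton, Set.insert_eq_of_mem h₀]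
  rw [A.latticePolynomial_eq_sum hA, Finset.sum_powerset_insert h0s,
    (A.deletion H₀).latticePolynomial_eq_sum (s := s) (φ := id) (by rw [Set.image_id, hs]; rfl),
    (A.restriction H₀).latticePolynomial_eq_sum hφ, Finset.mul_sum]
  refine congrArg₂ _ rfl (Finset.sum_congr rfl fun T hT => ?_)
  have hT0 : H₀ ∉ T := fun h => h0s (Finset.mem_powerset.1 hT h)
  have hinf : T.inf (fun H => H.comap H₀.subtype) = (T.inf id).comap H₀.subtype :=
    (Finset.apply_inf_eq_inf_comp (Submodule.comap H₀.subtype)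
      (fun _ _ => Submodule.comap_inf ..) (Submodule.comap_top _)).symm
  rw [Finset.inf_insert, id, finrank_quotient_inf (A.codim_eq_one H₀ h₀), hinf,
    Finset.card_insert_of_notMem hT0, Polynomial.X_mul_monomial]
  ring_nf

end combinatorics

end CentralArrangement

/-! ### Induction on the number of hyperplanes -/

theorem AddEquiv.finrank_of_prod {A B C : Type*} [AddCommGroup A] [AddCommGroup B]
    [AddCommGroup C] [mA : Module ℤ A] [mB : Module ℤ B] [mC : Module ℤ C] [Module.Free ℤ B]
    [Module.Finite ℤ B] [Module.Free ℤ C] [Module.Finite ℤ C] (e : A ≃+ B × C) :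
    Module.finrank ℤ A = Module.finrank ℤ B + Module.finrank ℤ C := by
  let _ := @Prod.instModule ℤ B C _ _ _ mB mC
  exact e.intLinearEquiv.finrank_eq.trans Module.finrank_prod

namespace CentralArrangement

variable {V : Type u} [AddCommGroup V] [Module ℍ[ℝ]ᵐᵒᵖ V]

theorem ncard_deletion_lt {A : CentralArrangement V} {H₀ : Submodule ℍ[ℝ]ᵐᵒᵖ V}
    (h₀ : H₀ ∈ A.hyperplanes) : (A.deletion H₀).hyperplanes.ncard < A.hyperplanes.ncard :=
  Set.ncard_sdiff_singleton_lt_of_mem h₀ A.finite_hyperplanes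

theorem ncard_restriction_lt {A : CentralArrangement V} {H₀ : Submodule ℍ[ℝ]ᵐᵒᵖ V}
    (h₀ : H₀ ∈ A.hyperplanes) : (A.restriction H₀).hyperplanes.ncard < A.hyperplanes.ncard :=
  (Set.ncard_image_le (A.finite_hyperplanes.sep _)).trans_lt
    (Set.ncard_lt_ncard ⟨Set.sep_subset _ _, fun h => (h h₀).2 le_rfl⟩ A.finite_hyperplanes)

variable [TopologicalSpace V]

theorem singularCohomology_of_isEmpty [ContinuousSMul ℍ[ℝ]ᵐᵒᵖ V] {A : CentralArrangement V}
    (hA : A.hyperplanes = ∅) :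
    Nonempty (singularCohomology A.complement 0 ≃ₗ[ℤ] ℤ) ∧
      ∀ n, Subsingleton (singularCohomology A.complement (n + 1)) := by
  let _ := realModule V
  have := continuousSMul_real (V := V)
  have hc : A.complement = Set.univ := by rw [complement, hA]; simp
  have e := nonempty_singularCohomology_subtype_equiv A.complement
  obtain ⟨h0, h1⟩ := relCohomology_of_vectorSpace V
  rw [← hc] at h0 h1
  exact ⟨⟨(e 0).some.trans h0.some⟩, fun n => (e (n + 1)).some.toEquiv.subsingleton_congr.2 (h1 n)⟩

theorem isThreeConcentrated_of_isEmpty [ContinuousSMul ℍ[ℝ]ᵐᵒᵖ V] {A : CentralArrangement V}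
    (hA : A.hyperplanes = ∅) : IsThreeConcentrated (singularCohomology A.complement) := by
  obtain ⟨⟨e⟩, h⟩ := singularCohomology_of_isEmpty hA
  refine ⟨fun d => ?_, fun d => ?_, fun d hd => ?_⟩
  · cases d with
    | zero => exact Module.Free.of_equiv e.symm
    | succ n => have := h n; infer_instance
  · cases d with
    | zero => exact Module.Finite.equiv e.symm
    | succ n => have := h n; infer_instance
  · cases d with
    | zero => exact absurd (dvd_zero 3) hd
    | succ n => exact h n

theorem poincareSeries_of_isEmpty [ContinuousSMul ℍ[ℝ]ᵐᵒᵖ V] {A : CentralArrangement V}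
    (hA : A.hyperplanes = ∅) : A.poincareSeries = 1 := by
  obtain ⟨⟨e⟩, h⟩ := singularCohomology_of_isEmpty hA
  ext d
  rw [poincareSeries, PowerSeries.coeff_mk, PowerSeries.coeff_one]
  cases d with
  | zero => rw [if_pos rfl, mul_zero, e.finrank_eq, Module.finrank_self, Nat.cast_one]
  | succ n =>
    have : Subsingleton (singularCohomology A.complement (3 * (n + 1))) := h (3 * n + 2)
    rw [if_neg n.succ_ne_zero, Module.finrank_zero_of_subsingleton, Nat.cast_zero]

variable [FiniteDimensional ℍ[ℝ]ᵐᵒᵖ V] [IsTopologicalAddGroup V] [ContinuousSMul ℍ[ℝ]ᵐᵒᵖ V]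
  [T2Space V]

theorem singularCohomology_deletion_restriction {A : CentralArrangement V}
    {H₀ : Submodule ℍ[ℝ]ᵐᵒᵖ V} (h₀ : H₀ ∈ A.hyperplanes)
    (h : IsThreeConcentrated (singularCohomology (A.deletion H₀).complement))
    (h' : IsThreeConcentrated (singularCohomology (A.restriction H₀).complement)) :
    IsThreeConcentrated (singularCohomology A.complement) ∧
      (∀ d < 3, Nonempty (singularCohomology A.complement d ≃ₗ[ℤ]
        singularCohomology (A.deletion H₀).complement d)) ∧
      ∀ d, Nonempty (singularCohomology A.complement (d + 3) ≃+
        singularCohomology (A.deletion H₀).complement (d + 3) ×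
          singularCohomology (A.restriction H₀).complement d) := by
  obtain ⟨j, hj, hjM, hΩ⟩ := A.exists_tube h₀
  exact singularCohomology_of_tube A.isOpen_complement hj hjM hΩ h h'

theorem poincareSeries_deletion_restriction {A : CentralArrangement V}
    {H₀ : Submodule ℍ[ℝ]ᵐᵒᵖ V} (h₀ : H₀ ∈ A.hyperplanes)
    (h : IsThreeConcentrated (singularCohomology (A.deletion H₀).complement))
    (h' : IsThreeConcentrated (singularCohomology (A.restriction H₀).complement)) :
    A.poincareSeries =
      (A.deletion H₀).poincareSeries + PowerSeries.X * (A.restriction H₀).poincareSeries := by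
  obtain ⟨-, e, e'⟩ := singularCohomology_deletion_restriction h₀ h h'
  ext d
  rw [map_add]
  cases d with
  | zero =>
    rw [PowerSeries.coeff_zero_X_mul, add_zero, poincareSeries, poincareSeries,
      PowerSeries.coeff_mk, PowerSeries.coeff_mk, mul_zero, (e 0 three_pos).some.finrank_eq]
  | succ n =>
    have := h.free (3 * n + 3)
    have := h.finite (3 * n + 3)
    have := h'.free (3 * n)
    have := h'.finite (3 * n)
    rw [PowerSeries.coeff_succ_X_mul, poincareSeries, poincareSeries, poincareSeries,
      PowerSeries.coeff_mk, PowerSeries.coeff_mk, PowerSeries.coeff_mk, mul_add_one,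
      (e' (3 * n)).some.finrank_of_prod, Nat.cast_add]

/-- The ambient space varies in the induction because the restriction lives in `H₀`. Both statements
are carried together: the recursion for ranks needs freeness and finiteness for the two smaller
arrangements. -/
theorem isThreeConcentrated_and_poincareSeries_eq (A : CentralArrangement V) :
    IsThreeConcentrated (singularCohomology A.complement) ∧
      A.poincareSeries = (A.latticePolynomial : PowerSeries ℤ) := by
  induction hn : A.hyperplanes.ncard using Nat.strong_induction_on generalizing V with
  | h n ih =>
    subst hn
    rcases A.hyperplanes.eq_empty_or_nonempty with hA | ⟨H₀, h₀⟩
    · refine ⟨isThreeConcentrated_of_isEmpty hA, ?_⟩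
      rw [poincareSeries_of_isEmpty hA, latticePolynomial_of_isEmpty hA, Polynomial.coe_one]
    · obtain ⟨h, hp⟩ := ih _ (ncard_deletion_lt h₀) (A.deletion H₀) rfl
      obtain ⟨h', hp'⟩ := ih _ (ncard_restriction_lt h₀) (A.restriction H₀) rfl
      refine ⟨(singularCohomology_deletion_restriction h₀ h h').1, ?_⟩
      rw [poincareSeries_deletion_restriction h₀ h h', hp, hp',
        A.latticePolynomial_deletion_restriction h₀, Polynomial.coe_add, Polynomial.coe_mul,
        Polynomial.coe_X]

end CentralArrangement

end

theorem mainTheorem2 {V : Type*} [AddCommGroup V] [Module ℍ[ℝ]ᵐᵒᵖ V]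
    [FiniteDimensional ℍ[ℝ]ᵐᵒᵖ V]
    [TopologicalSpace V] [IsTopologicalAddGroup V] [ContinuousSMul ℍ[ℝ]ᵐᵒᵖ V] [T2Space V]
    (A : CentralArrangement V) :
    -- the cohomology is free of finite rank and lives in degrees divisible by three
    (∀ d : ℕ, Module.Free ℤ (singularCohomology A.complement d) ∧
      Module.Finite ℤ (singularCohomology A.complement d)) ∧
    (∀ d : ℕ, ¬ 3 ∣ d → Subsingleton (singularCohomology A.complement d)) ∧
    -- deletion and restriction
    (∀ H₀ ∈ A.hyperplanes,
      (∀ d < 3, Nonempty (singularCohomology A.complement d ≃ₗ[ℤ]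
        singularCohomology (A.deletion H₀).complement d)) ∧
      (∀ d : ℕ, Nonempty (singularCohomology A.complement (d + 3) ≃ₗ[ℤ]
        singularCohomology (A.deletion H₀).complement (d + 3) ×
          singularCohomology (A.restriction H₀).complement d)) ∧
      A.poincareSeries =
        (A.deletion H₀).poincareSeries + PowerSeries.X * (A.restriction H₀).poincareSeries) ∧
    -- the ranks and the Möbius function of the intersection lattice
    (∀ d : ℕ, (Module.finrank ℤ (singularCohomology A.complement (3 * d)) : ℤ) =
      ∑ X : A.IntersectionLattice with X.rk = d, (-1) ^ X.rk * X.moebius) ∧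
    A.poincareSeries = (A.latticePolynomial : PowerSeries ℤ) := by
  obtain ⟨hA, hp⟩ := A.isThreeConcentrated_and_poincareSeries_eq
  refine ⟨fun d => ⟨hA.free d, hA.finite d⟩, hA.subsingleton, fun H₀ h₀ => ?_, fun d => ?_, hp⟩
  · have h := (A.deletion H₀).isThreeConcentrated_and_poincareSeries_eq.1
    have h' := (A.restriction H₀).isThreeConcentrated_and_poincareSeries_eq.1
    obtain ⟨-, e, e'⟩ := CentralArrangement.singularCohomology_deletion_restriction h₀ h h'
    exact ⟨e, fun d => ⟨(e' d).some.intLinearEquiv⟩,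
      CentralArrangement.poincareSeries_deletion_restriction h₀ h h'⟩
  · have h := congrArg (PowerSeries.coeff d) hp
    rw [CentralArrangement.poincareSeries, PowerSeries.coeff_mk, Polynomial.coeff_coe,
      CentralArrangement.latticePolynomial, Polynomial.finsetSum_coeff] at h
    rw [h, Finset.sum_filter]
    exact Finset.sum_congr rfl fun X _ => Polynomial.coeff_monomial
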